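/- Let $0<\kappa<1$ and let $F={}_2F_1$ be the Gauss hypergeometric function. Put $$f(T)=\int_0^T F\left(\tfrac14,\tfrac34;\tfrac12;\kappa^2\sin^2 t\right)\,dt$$ for complex $T$ near $0$; let $\phi$ be the analytic inverse of $f$ near $0$ with $\phi(0)=0$, and let $\psi$ be the analytic function near $0$ with $\psi(0)=0$ and $\sin\psi=\kappa\sin\phi$. Then the function $\cos\psi$, defined near $0$, extends to a unique meromorphic function $\mathrm{dn}_2$ on $\mathbb{C}$. There are real numbers $K_\kappa>0$ and $K_\kappa'>0$ such that $2K_\kappa$ and $2iK_\kappa'$ are fundamental periods of $\mathrm{dn}_2$, that is, the periods of $\mathrm{dn}_2$ are exactly the numbers $2mK_\kappa+2inK_\kappa'$ with $m,n\in\mathbb{Z}$. For any such numbers, the real half-period is $$K_\kappa=\tfrac{\pi}{2}\,F\left(\tfrac14,\tfrac34;1;\kappa^2\right).$$ -/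

import Mathlib

open scoped Topology

/-- `f(T) = ∫₀ᵀ F(1/4, 3/4; 1/2; κ² sin² t) dt`, the integral being taken along the straight
segment `t = s T`, `0 ≤ s ≤ 1`. Only its germ at `T = 0` is used. -/
noncomputable def dn2Integral (κ : ℝ) (T : ℂ) : ℂ :=
  ∫ s in (0 : ℝ)..1,
    T * ₂F₁ (1 / 4 : ℂ) (3 / 4 : ℂ) (1 / 2 : ℂ) ((κ : ℂ) ^ 2 * Complex.sin ((s : ℂ) * T) ^ 2)

/-- `d` is the elliptic function `dn₂` with modulus `κ`: it is meromorphic on `ℂ` and near `0` it is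
`cos ψ`, where `φ` is the local analytic inverse of `f` with `φ(0) = 0`, and `ψ` is analytic with
`ψ(0) = 0` and `sin ψ = κ sin φ`. (Normal form: removable singularities are removed and the
value at a pole is `0`, so that `d` is determined as a function `ℂ → ℂ`.) -/
structure IsDn2 (κ : ℝ) (d : ℂ → ℂ) : Prop where
  meromorphic : MeromorphicNFOn d Set.univ
  germ : ∃ φ ψ : ℂ → ℂ,
    AnalyticAt ℂ φ 0 ∧ φ 0 = 0 ∧ (∀ᶠ z in 𝓝 0, dn2Integral κ (φ z) = z) ∧
    AnalyticAt ℂ ψ 0 ∧ ψ 0 = 0 ∧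
    (∀ᶠ z in 𝓝 0, Complex.sin (ψ z) = κ * Complex.sin (φ z)) ∧
    (∀ᶠ z in 𝓝 0, d z = Complex.cos (ψ z))

/-- `2K` and `2iK'` are fundamental periods of `d`, with `K > 0` and `K' > 0`: the periods of `d`
are precisely their integer linear combinations. -/
structure IsFundamentalHalfPeriods (d : ℂ → ℂ) (K K' : ℝ) : Prop where
  pos : 0 < K
  pos' : 0 < K'
  periodic_iff : ∀ w : ℂ, Function.Periodic d w ↔
    ∃ m n : ℤ, w = m * (2 * (K : ℂ)) + n * (2 * (K' : ℂ) * Complex.I)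

open Filter

/-! ### Identity theorem for meromorphic functions -/

/-! Since `F(1/4,3/4;1/2;x²)` is the even part of `(1-x)^(-1/2)`, half-angle formulas give
`F(1/4,3/4;1/2;sin² w) cos w = cos (w/2)`. Differentiating `f(φ) = z` and `sin ψ = κ sin φ` then
yields `cos (ψ/2) ψ' = κ cos φ`, so `u = 1 - cos ψ` solves the elliptic equation `u'² = 2u(κ² - 2u +
u²)`, `u(0) = 0` (`isCubicGerm_one_sub_cos`). A nonconstant solution germ is unique
(`IsCubicGerm.eventuallyEq`). Uniqueness gives the duplication formula `IsCubicGerm.doubling`, which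
extends `u` meromorphically from a disc to discs of twice the radius, hence to `ℂ`.

For the periods, `dn₂` is computed on both axes. At `z = ∫₀ˣ F(1/4,3/4;1/2;κ² sin² t) dt` it equals
`√(1 - κ² sin² x)`. At `z = i ∫₀ˣ √2/√(1 - (1-κ²) cos⁴ t) dt` it equals `1/cos² x`, again by
uniqueness of the germ. Let `R` and `J` be these two integrals (without `i`) over `[0, π]`. Then `R`
and `iJ` are periods, and on the axes the value 1 is taken only at their integer multiples.
Conjugation symmetry puts every period in the half-lattice spanned by `R/2` and `iJ/2`, and values
at half-periods exclude the extra classes (`IsDn2.isFundamentalHalfPeriods`). So `K = R/2`, and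
termwise integration with Wallis' formula evaluates `R`. -/

theorem MeromorphicOn.eventuallyEq_nhdsNE_of_isPreconnected {f g : ℂ → ℂ} {U : Set ℂ}
    (hf : MeromorphicOn f U) (hg : MeromorphicOn g U) (hU : IsPreconnected U) {x y : ℂ}
    (hx : x ∈ U) (hy : y ∈ U) (h : ∃ᶠ z in 𝓝[≠] x, f z = g z) : f =ᶠ[𝓝[≠] y] g := by
  have h1 : meromorphicOrderAt (f - g) x = ⊤ := by
    rw [meromorphicOrderAt_eq_top_iff]
    filter_upwards [((hf x hx).frequently_eq_iff_eventuallyEq (hg x hx)).1 h] with z hz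
    simp [hz]
  have h2 : meromorphicOrderAt (f - g) y = ⊤ := by
    by_contra hne
    exact (hf.sub hg).meromorphicOrderAt_ne_top_of_isPreconnected hU hy hx hne h1
  rw [meromorphicOrderAt_eq_top_iff] at h2
  filter_upwards [h2] with z hz
  simpa [sub_eq_zero] using hz

/-- Normal form upgrades agreement on punctured neighbourhoods to agreement at every point, poles
included. `U` need not be open: it is later taken to be the real axis. -/
theorem MeromorphicNFOn.eqOn_of_isPreconnected {f g : ℂ → ℂ} {U : Set ℂ}
    (hf : MeromorphicNFOn f U) (hg : MeromorphicNFOn g U) (hU : IsPreconnected U) {x : ℂ}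
    (hx : x ∈ U) (h : ∃ᶠ z in 𝓝[≠] x, f z = g z) : Set.EqOn f g U := fun _ hy =>
  (((hf hy).eventuallyEq_nhdsNE_iff_eventuallyEq_nhds (hg hy)).1
    (hf.meromorphicOn.eventuallyEq_nhdsNE_of_isPreconnected hg.meromorphicOn hU hx hy h)).eq_of_nhds

theorem Filter.Eventually.frequently_nhdsNE {p : ℂ → Prop} {x : ℂ} (h : ∀ᶠ z in 𝓝 x, p z) :
    ∃ᶠ z in 𝓝[≠] x, p z :=
  (h.filter_mono nhdsWithin_le_nhds).frequently

theorem MeromorphicNFOn.eq_of_frequently_eq {f g : ℂ → ℂ} (hf : MeromorphicNFOn f Set.univ)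
    (hg : MeromorphicNFOn g Set.univ) {x : ℂ} (h : ∃ᶠ z in 𝓝[≠] x, f z = g z) : f = g :=
  funext fun _ => hf.eqOn_of_isPreconnected hg isPreconnected_univ (Set.mem_univ x) h
    (Set.mem_univ _)

/-! ### Conjugation -/

theorem AnalyticAt.conj_comp_conj {f : ℂ → ℂ} {x : ℂ} (hf : AnalyticAt ℂ f (starRingEnd ℂ x)) :
    AnalyticAt ℂ (fun z => starRingEnd ℂ (f (starRingEnd ℂ z))) x := by
  rw [Complex.analyticAt_iff_eventually_differentiableAt] at hf ⊢
  filter_upwards [Complex.continuous_conj.continuousAt.eventually hf] with z hz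
  simpa [Function.comp_def] using! hz.conj_conj

theorem MeromorphicNFAt.conj_comp_conj {f : ℂ → ℂ} {x : ℂ}
    (hf : MeromorphicNFAt f (starRingEnd ℂ x)) :
    MeromorphicNFAt (fun z => starRingEnd ℂ (f (starRingEnd ℂ z))) x := by
  rcases hf with h | ⟨n, g, hg, hg0, h⟩
  · left
    filter_upwards [Complex.continuous_conj.continuousAt.eventually h] with z hz
    simp [hz]
  · right
    refine ⟨n, _, hg.conj_comp_conj, by simpa using hg0, ?_⟩
    filter_upwards [Complex.continuous_conj.continuousAt.eventually h] with z hz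
    simp [hz]

/-! ### Meromorphic continuation by a doubling formula -/

/-- If `g` continues `u` to a ball, `R (g (z / 2))` continues it to the ball of twice the radius.
The hypothesis `hR` stands for rationality of `R`. -/
theorem MeromorphicOn.exists_meromorphicNFOn_ball {u : ℂ → ℂ} (hu : AnalyticAt ℂ u 0)
    {R : ℂ → ℂ} (hR : ∀ (f : ℂ → ℂ) (x : ℂ), MeromorphicAt f x → MeromorphicAt (fun z => R (f z)) x)
    (hdbl : ∀ᶠ z in 𝓝 0, u (2 * z) = R (u z)) :
    ∃ r : ℝ, 0 < r ∧ ∀ n : ℕ, ∃ g : ℂ → ℂ, MeromorphicNFOn g (Metric.ball 0 (2 ^ n * r)) ∧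
      ∀ᶠ z in 𝓝 0, g z = u z := by
  obtain ⟨r, hr, h⟩ := Metric.eventually_nhds_iff_ball.1 hu.eventually_analyticAt
  refine ⟨r, hr, fun n => ?_⟩
  induction n with
  | zero => exact ⟨u, fun z hz => (h z (by simpa using hz)).meromorphicNFAt, .of_forall fun _ => rfl⟩
  | succ n ih =>
    obtain ⟨g, hg, hgu⟩ := ih
    have hhalf : Tendsto (fun z : ℂ => z / 2) (𝓝 0) (𝓝 0) := by
      simpa using (continuous_id.div_const (2 : ℂ)).tendsto (0 : ℂ)
    have hG : MeromorphicOn (fun z => R (g (z / 2))) (Metric.ball 0 (2 ^ (n + 1) * r)) := by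
      intro z hz
      have hz' : z / 2 ∈ Metric.ball (0 : ℂ) (2 ^ n * r) := by
        simp only [mem_ball_zero_iff, norm_div, Complex.norm_ofNat] at hz ⊢
        rw [pow_succ] at hz; linarith
      exact (hR g _ (hg hz').meromorphicAt).comp_analyticAt (g := fun z : ℂ => z / 2) (by fun_prop)
    have h0 : (0 : ℂ) ∈ Metric.ball (0 : ℂ) (2 ^ (n + 1) * r) := by simp; positivity
    have heq : ∀ᶠ z in 𝓝 0, R (g (z / 2)) = u z := by
      filter_upwards [hhalf.eventually hgu, hhalf.eventually hdbl] with z h1 h2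
      rw [h1, ← h2]; congr 1; ring
    refine ⟨_, meromorphicNFOn_toMeromorphicNFOn (fun z => R (g (z / 2))) _, ?_⟩
    refine ((meromorphicNFOn_toMeromorphicNFOn _ _ h0).eventuallyEq_nhdsNE_iff_eventuallyEq_nhds
      hu.meromorphicNFAt).1 ?_
    exact (hG.toMeromorphicNFOn_eq_self_on_nhdsNE h0).trans (heq.filter_mono nhdsWithin_le_nhds)

/-- A germ `u` at `0` such that `u (2 z)` is an algebraic expression in `u z` extends to a
meromorphic function on `ℂ`. -/
theorem AnalyticAt.exists_meromorphicNFOn_univ_of_doubling {u : ℂ → ℂ} (hu : AnalyticAt ℂ u 0)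
    {R : ℂ → ℂ} (hR : ∀ (f : ℂ → ℂ) (x : ℂ), MeromorphicAt f x → MeromorphicAt (fun z => R (f z)) x)
    (hdbl : ∀ᶠ z in 𝓝 0, u (2 * z) = R (u z)) :
    ∃ g : ℂ → ℂ, MeromorphicNFOn g Set.univ ∧ ∀ᶠ z in 𝓝 0, g z = u z := by
  obtain ⟨r, hr, h⟩ := MeromorphicOn.exists_meromorphicNFOn_ball hu hR hdbl
  choose g hg hgu using h
  have hmono : ∀ {m n : ℕ}, m ≤ n → (2 : ℝ) ^ m * r ≤ 2 ^ n * r := fun {m n} hmn => by gcongr; norm_num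
  have hcomp : ∀ m n : ℕ, m ≤ n → Set.EqOn (g m) (g n) (Metric.ball 0 (2 ^ m * r)) := by
    intro m n hmn
    refine (hg m).eqOn_of_isPreconnected
      (fun z hz => hg n (Metric.ball_subset_ball (hmono hmn) hz))
      (convex_ball _ _).isPreconnected (x := 0) (by simp; positivity) ?_
    refine Filter.Eventually.frequently_nhdsNE ?_
    filter_upwards [hgu m, hgu n] with z h1 h2
    rw [h1, h2]
  have hex : ∀ z : ℂ, ∃ n : ℕ, z ∈ Metric.ball (0 : ℂ) (2 ^ n * r) := fun z => by
    obtain ⟨n, hn⟩ := pow_unbounded_of_one_lt (‖z‖ / r) (one_lt_two)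
    exact ⟨n, by simpa using (div_lt_iff₀ hr).1 hn⟩
  choose N hN using hex
  -- The glued value does not depend on the ball chosen to contain `z`.
  have key : ∀ n : ℕ, Set.EqOn (fun z => g (N z) z) (g n) (Metric.ball 0 (2 ^ n * r)) := by
    intro n z hz
    rcases le_total (N z) n with h | h
    · exact hcomp _ _ h (hN z)
    · exact (hcomp _ _ h hz).symm
  refine ⟨fun z => g (N z) z, fun z _ => ?_, ?_⟩
  · rw [meromorphicNFAt_congr ((key (N z)).eventuallyEq_of_mem (Metric.isOpen_ball.mem_nhds (hN z)))]
    exact hg _ (hN z)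
  · filter_upwards [hgu 0, Metric.ball_mem_nhds (0 : ℂ) (show 0 < 2 ^ 0 * r by positivity)]
      with z h1 h2
    exact (key 0 h2).trans h1

/-! ### Uniqueness for `(deriv u)² = P(u)` -/

/-- Compare orders of vanishing: if `e` had finite order `n` at 0, then `e''` would have order `n -
2`, while `c e` has order at least `n`. -/
theorem AnalyticAt.eventually_eq_zero_of_deriv_deriv_eq_mul {e c : ℂ → ℂ}
    (he : AnalyticAt ℂ e 0) (hc : AnalyticAt ℂ c 0) (h0 : e 0 = 0) (h1 : deriv e 0 = 0)
    (h : ∀ᶠ z in 𝓝 0, deriv (deriv e) z = c z * e z) : ∀ᶠ z in 𝓝 0, e z = 0 := by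
  rw [← analyticOrderAt_eq_top]
  have e1 := he.analyticOrderAt_deriv_add_one
  have e2 := he.deriv.analyticOrderAt_deriv_add_one
  simp only [h0, h1, sub_zero] at e1 e2
  have e3 : analyticOrderAt (deriv (deriv e)) 0 = analyticOrderAt c 0 + analyticOrderAt e 0 := by
    rw [← analyticOrderAt_mul hc he]
    exact analyticOrderAt_congr h
  rw [e3] at e2
  rw [← e2] at e1
  by_contra hne
  rw [← ne_eq, ENat.ne_top_iff_exists] at hne
  obtain ⟨n, hn⟩ := hne
  rw [← hn] at e1
  cases hc' : analyticOrderAt c 0 with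
  | top => simp [hc'] at e1
  | coe m => rw [hc'] at e1; norm_cast at e1; omega

/-- Differentiate and cancel `u'`, which is nonzero off 0 because `u` is not constant; the identity
theorem then covers 0. The second-order equation is needed because the first-order one also admits
the constant solution at a zero of `P`. -/
theorem AnalyticAt.deriv_deriv_eq_of_sq_deriv_eq {u P P' : ℂ → ℂ} (hu : AnalyticAt ℂ u 0)
    (hP : ∀ x, HasDerivAt P (P' x) x) (hP' : AnalyticAt ℂ P' (u 0))
    (h : ∀ᶠ z in 𝓝 0, deriv u z ^ 2 = P (u z))
    (hne : ¬ ∀ᶠ z in 𝓝 0, u z = u 0) :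
    ∀ᶠ z in 𝓝 0, deriv (deriv u) z = P' (u z) / 2 := by
  have hd : ∀ᶠ z in 𝓝[≠] 0, deriv u z ≠ 0 := by
    refine hu.deriv.eventually_eq_zero_or_eventually_ne_zero.resolve_left fun h0 => hne ?_
    have := hu.analyticOrderAt_deriv_add_one
    rw [analyticOrderAt_eq_top.2 h0, top_add] at this
    filter_upwards [analyticOrderAt_eq_top.1 this.symm] with z hz using sub_eq_zero.1 hz
  have hA : AnalyticAt ℂ (fun z => P' (u z) / 2) 0 := (hP'.comp hu).div_const
  refine (hu.deriv.deriv.frequently_eq_iff_eventually_eq hA).1 (Eventually.frequently ?_)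
  filter_upwards [hd, h.eventually_nhds.filter_mono nhdsWithin_le_nhds,
    hu.eventually_analyticAt.filter_mono nhdsWithin_le_nhds] with z h1 h2 h3
  have d1 : HasDerivAt (fun z => deriv u z ^ 2) (2 * deriv u z * deriv (deriv u) z) z := by
    simpa using! h3.deriv.differentiableAt.hasDerivAt.pow 2
  have d2 : HasDerivAt (fun z => P (u z)) (P' (u z) * deriv u z) z :=
    (hP (u z)).comp z h3.differentiableAt.hasDerivAt
  have := d1.unique (d2.congr_of_eventuallyEq h2)
  field_simp
  apply mul_right_cancel₀ h1
  linear_combination this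

/-- The germ `u` at `0` is a nonconstant solution of `(deriv u)² = 2 u (c - 2 u + u²)`, `u 0 = 0`. -/
structure IsCubicGerm (c : ℂ) (u : ℂ → ℂ) : Prop where
  analyticAt : AnalyticAt ℂ u 0
  map_zero : u 0 = 0
  sq_deriv : ∀ᶠ z in 𝓝 0, deriv u z ^ 2 = 2 * u z * (c - 2 * u z + u z ^ 2)
  ne_zero : ¬ ∀ᶠ z in 𝓝 0, u z = 0

/-! ### The cubic differential equation: uniqueness, duplication, continuation -/

namespace IsCubicGerm

variable {c : ℂ} {u v : ℂ → ℂ}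

theorem deriv_deriv (hu : IsCubicGerm c u) :
    ∀ᶠ z in 𝓝 0, deriv (deriv u) z = c - 4 * u z + 3 * u z ^ 2 := by
  have hP : ∀ x : ℂ, HasDerivAt (fun x : ℂ => 2 * x * (c - 2 * x + x ^ 2))
      (2 * (c - 4 * x + 3 * x ^ 2)) x := by
    intro x
    have := ((hasDerivAt_id x).const_mul 2).mul
      ((((hasDerivAt_id x).const_mul 2).const_sub c).add ((hasDerivAt_id x).pow 2))
    convert! this using 1
    simp; ring
  have := hu.analyticAt.deriv_deriv_eq_of_sq_deriv_eq hP (by fun_prop) hu.sq_deriv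
    (by rw [hu.map_zero]; exact hu.ne_zero)
  filter_upwards [this] with z hz
  rw [hz]; ring

theorem deriv_zero (hu : IsCubicGerm c u) : deriv u 0 = 0 := by
  have := hu.sq_deriv.self_of_nhds
  simpa [hu.map_zero] using this

theorem eventuallyEq (hu : IsCubicGerm c u) (hv : IsCubicGerm c v) : u =ᶠ[𝓝 0] v := by
  have key : ∀ᶠ z in 𝓝 0, (u - v) z = 0 := by
    refine (hu.analyticAt.sub hv.analyticAt).eventually_eq_zero_of_deriv_deriv_eq_mul
      -- Subtracting the two equations `u'' = c - 4u + 3u²` and factoring out `u - v` leaves this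
      -- coefficient.
      (c := fun z => -4 + 3 * (u z + v z)) ?_ ?_ ?_ ?_
    · have := hu.analyticAt
      have := hv.analyticAt
      fun_prop
    · simp [hu.map_zero, hv.map_zero]
    · rw [deriv_sub hu.analyticAt.differentiableAt hv.analyticAt.differentiableAt, hu.deriv_zero,
        hv.deriv_zero, sub_zero]
    · have hd : deriv (u - v) =ᶠ[𝓝 0] deriv u - deriv v := by
        filter_upwards [hu.analyticAt.eventually_analyticAt, hv.analyticAt.eventually_analyticAt]
          with z h1 h2
        exact deriv_sub h1.differentiableAt h2.differentiableAt
      filter_upwards [hd.deriv, hu.deriv_deriv, hv.deriv_deriv,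
        hu.analyticAt.deriv.eventually_analyticAt, hv.analyticAt.deriv.eventually_analyticAt]
        with z h1 h2 h3 h4 h5
      rw [h1, deriv_sub h4.differentiableAt h5.differentiableAt, h2, h3, Pi.sub_apply]
      ring
  filter_upwards [key] with z hz using sub_eq_zero.1 hz

/-- The doubling formula. -/
theorem doubling (hu : IsCubicGerm c u) (hc : c ≠ 0) : ∀ᶠ z in 𝓝 0,
    u (2 * z) = 4 * c * u z * (c - 2 * u z + u z ^ 2) / (c - u z ^ 2) ^ 2 := by
  -- This is the duplication formula of `y² = x(x² - 2x + c)`, translated by the 2-torsion point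
  -- `(0, 0)`, since `u` starts there. It solves the same equation, so uniqueness identifies it with
  -- `u`.
  let h : ℂ → ℂ := fun z => 4 * c * u (z / 2) * (c - 2 * u (z / 2) + u (z / 2) ^ 2) /
    (c - u (z / 2) ^ 2) ^ 2
  have hhalf : Tendsto (fun z : ℂ => z / 2) (𝓝 0) (𝓝 0) := by
    simpa using (continuous_id.div_const (2 : ℂ)).tendsto (0 : ℂ)
  have htwo : Tendsto (fun z : ℂ => 2 * z) (𝓝 0) (𝓝 0) := by
    simpa using (continuous_id.const_mul (2 : ℂ)).tendsto (0 : ℂ)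
  have hua : AnalyticAt ℂ (fun z => u (z / 2)) 0 :=
    AnalyticAt.fun_comp (by simpa using hu.analyticAt) (by fun_prop)
  have hden : ∀ᶠ z in 𝓝 0, c - u z ^ 2 ≠ 0 := by
    have : ContinuousAt (fun z => c - u z ^ 2) 0 :=
      continuousAt_const.sub (hu.analyticAt.continuousAt.pow 2)
    exact this.eventually_ne (by simpa [hu.map_zero] using hc)
  have hnum : ∀ᶠ z in 𝓝 0, c - 2 * u z + u z ^ 2 ≠ 0 := by
    have : ContinuousAt (fun z => c - 2 * u z + u z ^ 2) 0 := by
      have := hu.analyticAt.continuousAt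
      fun_prop
    exact this.eventually_ne (by simpa [hu.map_zero] using hc)
  have hh : IsCubicGerm c h := by
    refine ⟨?_, by simp [h, hu.map_zero], ?_, ?_⟩
    · refine AnalyticAt.div ((analyticAt_const.mul hua).mul ((analyticAt_const.sub
        (analyticAt_const.mul hua)).add (hua.pow 2))) ((analyticAt_const.sub (hua.pow 2)).pow 2) ?_
      simpa [hu.map_zero] using hc
    · filter_upwards [hhalf.eventually hu.sq_deriv, hhalf.eventually hden,
        hhalf.eventually hu.analyticAt.eventually_analyticAt] with z h1 h2 h3
      have d0 : HasDerivAt (fun z => u (z / 2)) (deriv u (z / 2) * (1 / 2)) z :=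
        h3.differentiableAt.hasDerivAt.comp z ((hasDerivAt_id z).div_const 2)
      have d1 := ((d0.const_mul (4 * c)).mul (((d0.const_mul 2).const_sub c).add (d0.pow 2))).div
        (((d0.pow 2).const_sub c).pow 2) (pow_ne_zero 2 h2)
      have d2 : deriv h z = _ := d1.deriv
      have d3 : deriv h z = deriv u (z / 2) * (2 * c * (c ^ 2 - 4 * c * u (z / 2) +
          6 * c * u (z / 2) ^ 2 - 4 * u (z / 2) ^ 3 + u (z / 2) ^ 4)) / (c - u (z / 2) ^ 2) ^ 3 := by
        rw [d2]
        simp only [Pi.pow_apply, Pi.mul_apply, Pi.add_apply]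
        field_simp
        ring
      rw [d3, div_pow, mul_pow, h1]
      simp only [h]
      field_simp
      ring
    · intro h0
      refine hu.ne_zero ?_
      filter_upwards [htwo.eventually h0, hden, hnum] with z h1 h2 h3
      simpa [h, hc, h2, h3] using h1
  filter_upwards [htwo.eventually (hu.eventuallyEq hh)] with z hz
  rw [hz]
  simp [h]

theorem exists_meromorphicNFOn (hu : IsCubicGerm c u) (hc : c ≠ 0) :
    ∃ g : ℂ → ℂ, MeromorphicNFOn g Set.univ ∧ ∀ᶠ z in 𝓝 0, g z = u z := by
  refine hu.analyticAt.exists_meromorphicNFOn_univ_of_doubling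
    (R := fun x => 4 * c * x * (c - 2 * x + x ^ 2) / (c - x ^ 2) ^ 2) (fun f x hf => ?_)
    (hu.doubling hc)
  fun_prop

end IsCubicGerm

/-! ### The hypergeometric functions -/

section Hypergeometric

variable {𝕂 : Type*} [RCLike 𝕂] {a b c : 𝕂}

theorem hasFPowerSeriesOnBall_ordinaryHypergeometric
    (h : ∀ k : ℕ, (k : 𝕂) ≠ -a ∧ (k : 𝕂) ≠ -b ∧ (k : 𝕂) ≠ -c) :
    HasFPowerSeriesOnBall (₂F₁ a b c : 𝕂 → 𝕂) (ordinaryHypergeometricSeries 𝕂 a b c) 0 1 := by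
  have hr := ordinaryHypergeometricSeries_radius_eq_one 𝕂 a b c h
  have := (ordinaryHypergeometricSeries 𝕂 a b c).hasFPowerSeriesOnBall (by rw [hr]; exact one_pos)
  rwa [hr] at this

theorem hasSum_ordinaryHypergeometric
    (h : ∀ k : ℕ, (k : 𝕂) ≠ -a ∧ (k : 𝕂) ≠ -b ∧ (k : 𝕂) ≠ -c) {x : 𝕂} (hx : ‖x‖ < 1) :
    HasSum (fun n => ordinaryHypergeometricCoefficient a b c n * x ^ n) (₂F₁ a b c x) := by
  have := (hasFPowerSeriesOnBall_ordinaryHypergeometric h).hasSum (y := x)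
    (by simpa [enorm_eq_nnnorm, ← NNReal.coe_lt_one] using hx)
  simpa only [ordinaryHypergeometricSeries_apply_eq, smul_eq_mul, zero_add] using this

theorem analyticAt_ordinaryHypergeometric
    (h : ∀ k : ℕ, (k : 𝕂) ≠ -a ∧ (k : 𝕂) ≠ -b ∧ (k : 𝕂) ≠ -c) {x : 𝕂} (hx : ‖x‖ < 1) :
    AnalyticAt 𝕂 (₂F₁ a b c : 𝕂 → 𝕂) x :=
  (hasFPowerSeriesOnBall_ordinaryHypergeometric h).analyticAt_of_mem
    (by simpa [enorm_eq_nnnorm, ← NNReal.coe_lt_one] using hx)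

theorem ofReal_ordinaryHypergeometric (a b c x : ℝ) :
    ((₂F₁ a b c x : ℝ) : ℂ) = ₂F₁ (a : ℂ) (b : ℂ) (c : ℂ) (x : ℂ) := by
  have h : ∀ (n : ℕ) (t : ℝ), (ascPochhammer ℂ n).eval (t : ℂ) = ((ascPochhammer ℝ n).eval t : ℝ) := by
    intro n t
    rw [← ascPochhammer_map Complex.ofRealHom n, Polynomial.eval_map]
    exact Polynomial.eval₂_at_apply Complex.ofRealHom t
  simp only [ordinaryHypergeometric_eq_tsum, Complex.ofReal_tsum, h, smul_eq_mul]
  push_cast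
  rfl

end Hypergeometric

theorem natCast_ne_neg_of_pos {t : ℝ} (ht : 0 < t) (k : ℕ) : (k : ℝ) ≠ -t := by
  have : (0 : ℝ) ≤ k := k.cast_nonneg
  linarith

theorem natCast_ne_neg_ofReal_of_pos {t : ℝ} (ht : 0 < t) (k : ℕ) : (k : ℂ) ≠ -(t : ℂ) := by
  exact_mod_cast natCast_ne_neg_of_pos ht k

theorem natCast_ne_neg_params (k : ℕ) :
    (k : ℂ) ≠ -(1 / 4 : ℂ) ∧ (k : ℂ) ≠ -(3 / 4 : ℂ) ∧ (k : ℂ) ≠ -(1 / 2 : ℂ) := by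
  refine ⟨?_, ?_, ?_⟩
  · simpa using natCast_ne_neg_ofReal_of_pos (t := 1 / 4) (by norm_num) k
  · simpa using natCast_ne_neg_ofReal_of_pos (t := 3 / 4) (by norm_num) k
  · simpa using natCast_ne_neg_ofReal_of_pos (t := 1 / 2) (by norm_num) k

theorem ordinaryHypergeometric_pos {a b c x : ℝ} (ha : 0 < a) (hb : 0 < b) (hc : 0 < c)
    (hx0 : 0 ≤ x) (hx1 : x < 1) : 0 < ₂F₁ a b c x := by
  have hs := hasSum_ordinaryHypergeometric (a := a) (b := b) (c := c) (x := x)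
    (fun k => ⟨natCast_ne_neg_of_pos ha k, natCast_ne_neg_of_pos hb k, natCast_ne_neg_of_pos hc k⟩)
    (by rwa [Real.norm_of_nonneg hx0])
  have hnn : ∀ n, 0 ≤ ordinaryHypergeometricCoefficient a b c n * x ^ n := fun n => by
    have := ascPochhammer_pos n a ha
    have := ascPochhammer_pos n b hb
    have := ascPochhammer_pos n c hc
    unfold ordinaryHypergeometricCoefficient
    positivity
  have := hs.summable.sum_le_tsum {0} (fun n _ => hnn n)
  rw [hs.tsum_eq] at this
  simp [ordinaryHypergeometricCoefficient] at this
  linarith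

/-- The left side is the coefficient of `x^(2n)` in `(1-x)^(-1/2)`. -/
theorem ascPochhammer_eval_half_two_mul (n : ℕ) :
    (ascPochhammer ℂ (2 * n)).eval (1 / 2 : ℂ) * (Nat.factorial (2 * n) : ℂ)⁻¹ =
      ordinaryHypergeometricCoefficient (1 / 4 : ℂ) (3 / 4) (1 / 2) n := by
  have hh : ∀ n : ℕ, (1 / 2 : ℂ) + n ≠ 0 := fun n => by
    have := (natCast_ne_neg_params n).2.2
    intro h; apply this; linear_combination h
  unfold ordinaryHypergeometricCoefficient
  induction n with
  | zero => simp
  | succ n ih =>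
    have h1 : ((n : ℂ) + 1) ≠ 0 := by exact_mod_cast n.succ_ne_zero
    have h2 : ((2 * n : ℂ) + 1) ≠ 0 := by exact_mod_cast (2 * n).succ_ne_zero
    have h3 : ((2 * n : ℂ) + 1 + 1) ≠ 0 := by exact_mod_cast (2 * n + 1).succ_ne_zero
    have h4 := hh n
    rw [show 2 * (n + 1) = 2 * n + 1 + 1 by ring]
    simp only [ascPochhammer_succ_eval, Nat.factorial_succ, Nat.cast_mul, mul_inv]
    push_cast
    calc _ = (ascPochhammer ℂ (2 * n)).eval (1 / 2 : ℂ) * (Nat.factorial (2 * n) : ℂ)⁻¹ *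
          ((1 / 2 + 2 * n) * (1 / 2 + (2 * n + 1)) * (2 * n + 1 + 1 : ℂ)⁻¹ * (2 * n + 1 : ℂ)⁻¹) := by
          ring
      _ = _ := by
          rw [ih]
          have : ((1 / 2 + 2 * n) * (1 / 2 + (2 * n + 1)) * (2 * n + 1 + 1 : ℂ)⁻¹ *
              (2 * n + 1 : ℂ)⁻¹) = (1 / 4 + n) * (3 / 4 + n) * (n + 1 : ℂ)⁻¹ * (1 / 2 + n : ℂ)⁻¹ := by
            rw [show (1 / 2 + n : ℂ) = (2 * n + 1) / 2 by ring]
            field_simp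
            ring
          rw [this]
          ring

theorem hasSum_one_div_one_sub_cpow_half {x : ℂ} (hx : ‖x‖ < 1) :
    HasSum (fun n : ℕ => (ascPochhammer ℂ n).eval (1 / 2 : ℂ) * (Nat.factorial n : ℂ)⁻¹ * x ^ n)
      (1 / (1 - x) ^ (1 / 2 : ℂ)) := by
  have := (Complex.one_div_one_sub_cpow_hasFPowerSeriesOnBall_zero (1 / 2)).hasSum (y := x)
    (by simpa [enorm_eq_nnnorm, ← NNReal.coe_lt_one] using hx)
  simp only [zero_add, FormalMultilinearSeries.ofScalars_apply_eq, smul_eq_mul] at this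
  convert! this using 2 with n
  congr 1
  have h := Ring.factorial_nsmul_multichoose_eq_ascPochhammer (1 / 2 : ℂ) n
  rw [Polynomial.ascPochhammer_smeval_eq_eval, Ring.multichoose_eq, nsmul_eq_mul] at h
  rw [← h]
  have : (Nat.factorial n : ℂ) ≠ 0 := by exact_mod_cast n.factorial_ne_zero
  field_simp

theorem ordinaryHypergeometric_sq {x : ℂ} (hx : ‖x‖ < 1) :
    ₂F₁ (1 / 4 : ℂ) (3 / 4 : ℂ) (1 / 2 : ℂ) (x ^ 2) =
      (1 / (1 - x) ^ (1 / 2 : ℂ) + 1 / (1 + x) ^ (1 / 2 : ℂ)) / 2 := by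
  have h1 := hasSum_one_div_one_sub_cpow_half hx
  have h2 := hasSum_one_div_one_sub_cpow_half (x := -x) (by simpa using hx)
  have h3 := (h1.add h2).div_const 2
  rw [sub_neg_eq_add] at h3
  have h4 := hasSum_ordinaryHypergeometric (x := x ^ 2) natCast_ne_neg_params
    (by rw [norm_pow]; exact pow_lt_one₀ (norm_nonneg _) hx two_ne_zero)
  refine h4.unique ?_
  -- Odd powers cancel between the expansions at `x` and `-x`, so the sum runs over even exponents.
  rw [← (mul_right_injective₀ (two_ne_zero (α := ℕ))).hasSum_iff] at h3
  · convert! h3 using 2 with n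
    rw [← ascPochhammer_eval_half_two_mul]
    simp [pow_mul]
  · intro n hn
    have : Odd n := by
      rw [← Nat.not_even_iff_odd]
      rintro ⟨k, rfl⟩
      exact hn ⟨k, by simp [two_mul]⟩
    simp [this.neg_pow]

/-- `1 ± sin w = (cos (w/2) ± sin (w/2))²`; near 0 these bases have positive real part, so the
principal roots are the bases themselves, and their product is `cos w`. -/
theorem ordinaryHypergeometric_sin_sq :
    ∀ᶠ w in 𝓝 (0 : ℂ), ₂F₁ (1 / 4 : ℂ) (3 / 4 : ℂ) (1 / 2 : ℂ) (Complex.sin w ^ 2) *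
      Complex.cos w = Complex.cos (w / 2) := by
  have c1 : ContinuousAt (fun w : ℂ => ‖Complex.sin w‖) 0 := by fun_prop
  have c2 : ContinuousAt (fun w : ℂ => (Complex.cos (w / 2) - Complex.sin (w / 2)).re) 0 := by fun_prop
  have c3 : ContinuousAt (fun w : ℂ => (Complex.cos (w / 2) + Complex.sin (w / 2)).re) 0 := by fun_prop
  filter_upwards [c1.eventually_lt_const (u := 1) (by simp), c2.eventually_const_lt (u := 0) (by simp),
    c3.eventually_const_lt (u := 0) (by simp)] with w h1 h2 h3
  have s : Complex.sin w = 2 * Complex.sin (w / 2) * Complex.cos (w / 2) := by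
    rw [← Complex.sin_two_mul]; congr 1; ring
  have k : Complex.cos w = 2 * Complex.cos (w / 2) ^ 2 - 1 := by
    rw [← Complex.cos_two_mul]; congr 1; ring
  have p := Complex.sin_sq_add_cos_sq (w / 2)
  have e1 : 1 - Complex.sin w = (Complex.cos (w / 2) - Complex.sin (w / 2)) ^ 2 := by
    rw [s]; linear_combination -p
  have e2 : 1 + Complex.sin w = (Complex.cos (w / 2) + Complex.sin (w / 2)) ^ 2 := by
    rw [s]; linear_combination -p
  rw [ordinaryHypergeometric_sq h1, e1, e2, one_div (2 : ℂ), Complex.sq_cpow_two_inv h2,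
    Complex.sq_cpow_two_inv h3]
  have n1 : Complex.cos (w / 2) - Complex.sin (w / 2) ≠ 0 := fun h => by simp [h] at h2
  have n2 : Complex.cos (w / 2) + Complex.sin (w / 2) ≠ 0 := fun h => by simp [h] at h3
  rw [k]
  field_simp
  linear_combination 2 * Complex.cos (w / 2) * p

/-- The Wallis product is `(1/2)_n / (1)_n`, so it changes the lower parameter from `1/2` to `1`. -/
theorem ordinaryHypergeometricCoefficient_mul_prod (n : ℕ) :
    ordinaryHypergeometricCoefficient (1 / 4 : ℝ) (3 / 4) (1 / 2) n *
      ∏ i ∈ Finset.range n, (2 * (i : ℝ) + 1) / (2 * i + 2) =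
      ordinaryHypergeometricCoefficient (1 / 4 : ℝ) (3 / 4) 1 n := by
  have h : ∏ i ∈ Finset.range n, (2 * (i : ℝ) + 1) / (2 * i + 2) =
      (ascPochhammer ℝ n).eval (1 / 2) * ((ascPochhammer ℝ n).eval 1)⁻¹ := by
    induction n with
    | zero => simp
    | succ n ih =>
      rw [Finset.prod_range_succ, ih]
      simp only [ascPochhammer_succ_eval, mul_inv]
      have : (2 * (n : ℝ) + 1) / (2 * n + 2) = (1 / 2 + n) * (1 + n : ℝ)⁻¹ := by
        field_simp
        ring
      rw [this]; ring
  have := (ascPochhammer_pos n (1 / 2 : ℝ) (by norm_num)).ne'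
  rw [h]
  unfold ordinaryHypergeometricCoefficient
  field_simp

theorem integral_ordinaryHypergeometric_sin_sq {κ : ℝ} (hκ₀ : 0 ≤ κ) (hκ₁ : κ < 1) :
    ∫ t in (0 : ℝ)..Real.pi, ₂F₁ (1 / 4 : ℝ) (3 / 4 : ℝ) (1 / 2 : ℝ) (κ ^ 2 * Real.sin t ^ 2) =
      Real.pi * ₂F₁ (1 / 4 : ℝ) (3 / 4 : ℝ) (1 : ℝ) (κ ^ 2) := by
  have hκ2 : κ ^ 2 < 1 := pow_lt_one₀ hκ₀ hκ₁ two_ne_zero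
  have hk : ∀ c : ℝ, 0 < c → ∀ k : ℕ, (k : ℝ) ≠ -(1 / 4) ∧ (k : ℝ) ≠ -(3 / 4) ∧ (k : ℝ) ≠ -c :=
    fun c hc k => ⟨natCast_ne_neg_of_pos (by norm_num) k, natCast_ne_neg_of_pos (by norm_num) k,
      natCast_ne_neg_of_pos hc k⟩
  have hs : ∀ {c x : ℝ}, 0 < c → 0 ≤ x → x < 1 →
      HasSum (fun n => ordinaryHypergeometricCoefficient (1 / 4 : ℝ) (3 / 4) c n * x ^ n)
        (₂F₁ (1 / 4 : ℝ) (3 / 4 : ℝ) c x) := fun hc h0 h1 =>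
    hasSum_ordinaryHypergeometric (hk _ hc) (by rwa [Real.norm_of_nonneg h0])
  have hpos : ∀ n, 0 ≤ ordinaryHypergeometricCoefficient (1 / 4 : ℝ) (3 / 4) (1 / 2) n := fun n => by
    have := ascPochhammer_pos n (1 / 4 : ℝ) (by norm_num)
    have := ascPochhammer_pos n (3 / 4 : ℝ) (by norm_num)
    have := ascPochhammer_pos n (1 / 2 : ℝ) (by norm_num)
    unfold ordinaryHypergeometricCoefficient
    positivity
  have hsin : ∀ t : ℝ, κ ^ 2 * Real.sin t ^ 2 ≤ κ ^ 2 := fun t =>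
    mul_le_of_le_one_right (sq_nonneg κ) (Real.sin_sq_le_one t)
  have h1 := intervalIntegral.hasSum_integral_of_dominated_convergence (μ := MeasureTheory.volume)
    (a := 0) (b := Real.pi)
    (F := fun n t => ordinaryHypergeometricCoefficient (1 / 4 : ℝ) (3 / 4) (1 / 2) n *
      (κ ^ 2 * Real.sin t ^ 2) ^ n)
    (f := fun t => ₂F₁ (1 / 4 : ℝ) (3 / 4 : ℝ) (1 / 2 : ℝ) (κ ^ 2 * Real.sin t ^ 2))
    -- The coefficients are nonnegative, so the series at `sin² t = 1` dominates and converges as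
    -- `κ² < 1`.
    (fun n _ => ordinaryHypergeometricCoefficient (1 / 4 : ℝ) (3 / 4) (1 / 2) n * (κ ^ 2) ^ n)
    (fun n => Continuous.aestronglyMeasurable (by fun_prop))
    (fun n => .of_forall fun t _ => by
      have := hpos n
      rw [Real.norm_of_nonneg (by positivity)]
      gcongr
      exact hsin t)
    (.of_forall fun t _ => (hs (by norm_num) (sq_nonneg κ) hκ2).summable)
    intervalIntegrable_const
    (.of_forall fun t _ => hs (by norm_num) (by positivity) ((hsin t).trans_lt hκ2))
  refine h1.unique ?_
  convert! (hs one_pos (sq_nonneg κ) hκ2).mul_left Real.pi using 2 with n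
  rw [← ordinaryHypergeometricCoefficient_mul_prod, intervalIntegral.integral_const_mul]
  simp_rw [mul_pow, ← pow_mul]
  rw [intervalIntegral.integral_const_mul, integral_sin_pow_even]
  ring

/-! ### Primitives along segments -/

/-- The integral of `g` along the segment from `0` to `T`. -/
noncomputable def segmentIntegral (g : ℂ → ℂ) (T : ℂ) : ℂ :=
  ∫ s in (0 : ℝ)..1, T * g ((s : ℂ) * T)

/-- A holomorphic function on a convex open set has a primitive `G`, and the segment integral is `G
T - G 0`. -/
theorem hasDerivAt_segmentIntegral {g : ℂ → ℂ} {S : Set ℂ} (hS : Convex ℝ S) (hSo : IsOpen S)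
    (h0 : (0 : ℂ) ∈ S) (hg : DifferentiableOn ℂ g S) {T : ℂ} (hT : T ∈ S) :
    HasDerivAt (segmentIntegral g) (g T) T := by
  obtain ⟨G, hG⟩ := hS.exists_forall_hasDerivWithinAt hg
  have hG' : ∀ z ∈ S, HasDerivAt G (g z) z := fun z hz => (hG z hz).hasDerivAt (hSo.mem_nhds hz)
  have key : ∀ z ∈ S, segmentIntegral g z = G z - G 0 := by
    intro z hz
    have hmem : ∀ s ∈ Set.uIcc (0 : ℝ) 1, (s : ℂ) * z ∈ S := fun s hs => by
      rw [Set.uIcc_of_le zero_le_one] at hs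
      simpa using hS h0 hz (sub_nonneg.2 hs.2) hs.1 (by ring)
    have hd : ∀ s ∈ Set.uIcc (0 : ℝ) 1,
        HasDerivAt (fun s : ℝ => G ((s : ℂ) * z)) (z * g ((s : ℂ) * z)) s := fun s hs => by
      have h1 : HasDerivAt (fun s : ℝ => (s : ℂ) * z) z s := by
        simpa using (Complex.ofRealCLM.hasDerivAt (x := s)).mul_const z
      have := (hG' _ (hmem s hs)).comp s h1
      rwa [mul_comm] at this
    have hc : ContinuousOn (fun s : ℝ => z * g ((s : ℂ) * z)) (Set.uIcc 0 1) :=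
      continuousOn_const.mul (hg.continuousOn.comp (by fun_prop) hmem)
    rw [segmentIntegral, intervalIntegral.integral_eq_sub_of_hasDerivAt hd hc.intervalIntegrable]
    simp
  refine ((hG' T hT).sub_const (G 0)).congr_of_eventuallyEq ?_
  filter_upwards [hSo.mem_nhds hT] with z hz using key z hz

theorem segmentIntegral_ofReal {g : ℂ → ℂ} {γ : ℝ → ℝ} (h : ∀ x : ℝ, g x = γ x) (x : ℝ) :
    segmentIntegral g x = ((∫ t in (0 : ℝ)..x, γ t : ℝ) : ℂ) := by
  have h1 := intervalIntegral.mul_integral_comp_mul_right (a := 0) (b := 1) (f := γ) (c := x)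
  rw [zero_mul, one_mul] at h1
  rw [← h1, segmentIntegral, intervalIntegral.integral_const_mul, Complex.ofReal_mul,
    ← intervalIntegral.integral_ofReal]
  congr 1
  refine intervalIntegral.integral_congr fun s _ => ?_
  rw [← h]; push_cast; rfl

/-- The open horizontal strip of half-width `δ` around the real axis. -/
def realStrip (δ : ℝ) : Set ℂ := Complex.im ⁻¹' Set.Ioo (-δ) δ

theorem convex_realStrip (δ : ℝ) : Convex ℝ (realStrip δ) :=
  (convex_Ioo (-δ) δ).linear_preimage Complex.imLm

theorem isOpen_realStrip (δ : ℝ) : IsOpen (realStrip δ) :=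
  isOpen_Ioo.preimage Complex.continuous_im

theorem ofReal_mem_realStrip {δ : ℝ} (hδ : 0 < δ) (x : ℝ) : (x : ℂ) ∈ realStrip δ := by
  simp [realStrip, hδ]

theorem norm_exp_mul_I (z : ℂ) : ‖Complex.exp (z * Complex.I)‖ = Real.exp (-z.im) := by
  simp [Complex.norm_exp]

theorem norm_cos_le_cosh_im (z : ℂ) : ‖Complex.cos z‖ ≤ Real.cosh z.im := by
  rw [Complex.cos, Real.cosh_eq, norm_div, Complex.norm_ofNat]
  refine div_le_div_of_nonneg_right ((norm_add_le _ _).trans ?_) zero_le_two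
  rw [norm_exp_mul_I, norm_exp_mul_I]
  simp [add_comm]

theorem norm_sin_le_cosh_im (z : ℂ) : ‖Complex.sin z‖ ≤ Real.cosh z.im := by
  rw [Complex.sin, Real.cosh_eq, norm_div, Complex.norm_ofNat, norm_mul, Complex.norm_I, mul_one]
  refine div_le_div_of_nonneg_right ((norm_sub_le _ _).trans ?_) zero_le_two
  rw [norm_exp_mul_I, norm_exp_mul_I]
  simp

/-- Together with `|sin z|, |cos z| ≤ cosh (Im z)`, this yields a uniform strip on which both
integrands are holomorphic. -/
theorem exists_realStrip_mul_cosh_pow_lt_one {r : ℝ} (hr : r < 1) (n : ℕ) :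
    ∃ δ > 0, ∀ z ∈ realStrip δ, r * Real.cosh z.im ^ n < 1 := by
  have : ContinuousAt (fun y : ℝ => r * Real.cosh y ^ n) 0 := by
    have := Real.continuous_cosh
    fun_prop
  obtain ⟨δ, hδ, h⟩ := Metric.eventually_nhds_iff.1
    (this.eventually_lt_const (u := 1) (by simpa using hr))
  exact ⟨δ, hδ, fun z hz => h (by simpa [Real.dist_eq, abs_lt, realStrip] using hz)⟩

/-! ### Values of a meromorphic function along a line -/

/-- As functions of the parameter, both sides are in normal form along the real axis, so their
agreement near 0 propagates along it, through poles as well. -/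
theorem MeromorphicNFOn.eq_on_line {d : ℂ → ℂ} (hd : MeromorphicNFOn d Set.univ) {c : ℂ}
    {g h : ℂ → ℂ} {γ : ℝ → ℝ} {δ : ℝ} (hδ : 0 < δ) (hg : DifferentiableOn ℂ g (realStrip δ))
    (hγ : ∀ x : ℝ, g x = γ x) (hh : ∀ x : ℝ, MeromorphicNFAt h x)
    (hgerm : ∀ᶠ θ in 𝓝 0, d (c * segmentIntegral g θ) = h θ) (x : ℝ) :
    d (c * ((∫ t in (0 : ℝ)..x, γ t : ℝ) : ℂ)) = h x := by
  have h0 : (0 : ℂ) ∈ realStrip δ := by simpa using ofReal_mem_realStrip hδ 0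
  have hdiff : DifferentiableOn ℂ (segmentIntegral g) (realStrip δ) := fun z hz =>
    (hasDerivAt_segmentIntegral (convex_realStrip δ) (isOpen_realStrip δ) h0 hg
      hz).differentiableAt.differentiableWithinAt
  have hpre : IsPreconnected (Set.range ((↑) : ℝ → ℂ)) :=
    isPreconnected_range Complex.continuous_ofReal
  have h1 : MeromorphicNFOn (fun z => d (c * segmentIntegral g z)) (Set.range ((↑) : ℝ → ℂ)) := by
    rintro _ ⟨y, rfl⟩
    have ha : AnalyticAt ℂ (fun z => c * segmentIntegral g z) y :=
      analyticAt_const.mul (hdiff.analyticAt ((isOpen_realStrip δ).mem_nhds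
        (ofReal_mem_realStrip hδ y)))
    exact (hd (Set.mem_univ _)).comp_analyticAt ha
  have h2 : MeromorphicNFOn h (Set.range ((↑) : ℝ → ℂ)) := by
    rintro _ ⟨y, rfl⟩
    exact hh y
  have := h1.eqOn_of_isPreconnected h2 hpre (x := 0) ⟨0, by simp⟩ hgerm.frequently_nhdsNE
    (Set.mem_range_self x)
  beta_reduce at this
  rwa [segmentIntegral_ofReal hγ] at this

theorem MeromorphicNFOn.periodic_of_line {d : ℂ → ℂ} (hd : MeromorphicNFOn d Set.univ) {c ω : ℂ}
    (hc : c ≠ 0) (h : ∀ x : ℝ, d (c * x + ω) = d (c * x)) : Function.Periodic d ω := by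
  have h1 : MeromorphicNFOn (fun z => d (z + ω)) Set.univ := fun z _ =>
    (hd (Set.mem_univ (z + ω))).comp_analyticAt (g := fun z => z + ω) (by fun_prop)
  refine congrFun (h1.eq_of_frequently_eq hd (x := 0) ?_)
  have ht : Tendsto (fun x : ℝ => c * (x : ℂ)) (𝓝[≠] 0) (𝓝[≠] 0) := by
    refine tendsto_nhdsWithin_iff.2 ⟨?_, ?_⟩
    · have : Continuous fun x : ℝ => c * (x : ℂ) := by fun_prop
      simpa using (this.tendsto 0).mono_left nhdsWithin_le_nhds
    · filter_upwards [self_mem_nhdsWithin] with x hx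
      simpa [hc] using hx
  exact ht.frequently (Eventually.frequently (.of_forall fun x => h x))

/-! ### Primitives of positive periodic functions -/

section PeriodicPrimitive

variable {γ : ℝ → ℝ}

theorem integral_add_pi (hγ : Continuous γ) (hper : Function.Periodic γ Real.pi) (x : ℝ) :
    ∫ t in (0 : ℝ)..(x + Real.pi), γ t =
      (∫ t in (0 : ℝ)..x, γ t) + ∫ t in (0 : ℝ)..Real.pi, γ t := by
  rw [← intervalIntegral.integral_add_adjacent_intervals (hγ.intervalIntegrable 0 x)
    (hγ.intervalIntegrable x (x + Real.pi)), hper.intervalIntegral_add_eq x 0, zero_add]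

theorem integral_int_mul_pi (hγ : Continuous γ) (hper : Function.Periodic γ Real.pi) (m : ℤ) :
    ∫ t in (0 : ℝ)..(m * Real.pi), γ t = m * ∫ t in (0 : ℝ)..Real.pi, γ t := by
  induction m using Int.induction_on with
  | zero => simp
  | succ n ih =>
    push_cast at ih ⊢
    rw [add_mul, one_mul, integral_add_pi hγ hper, ih]; ring
  | pred n ih =>
    have := integral_add_pi hγ hper ((-(n : ℤ) - 1 : ℤ) * Real.pi)
    rw [show (((-(n : ℤ) - 1 : ℤ) : ℝ) * Real.pi + Real.pi) = ((-(n : ℤ) : ℤ) : ℝ) * Real.pi by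
      push_cast; ring, ih] at this
    push_cast at this ⊢
    linarith

theorem integral_pi_pos (hγ : Continuous γ) (hpos : ∀ x, 0 < γ x) :
    0 < ∫ t in (0 : ℝ)..Real.pi, γ t :=
  intervalIntegral.intervalIntegral_pos_of_pos (hγ.intervalIntegrable _ _) hpos Real.pi_pos

/-- The primitive grows by a fixed positive amount per period, so it is unbounded in both
directions. -/
theorem exists_integral_eq (hγ : Continuous γ) (hper : Function.Periodic γ Real.pi)
    (hpos : ∀ x, 0 < γ x) (y : ℝ) : ∃ x : ℝ, ∫ t in (0 : ℝ)..x, γ t = y := by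
  have hΩ := integral_pi_pos hγ hpos
  have hc : Continuous fun x : ℝ => ∫ t in (0 : ℝ)..x, γ t :=
    intervalIntegral.continuous_primitive (fun a b => hγ.intervalIntegrable a b) 0
  refine mem_range_of_exists_le_of_exists_ge hc
    ⟨⌊y / ∫ t in (0 : ℝ)..Real.pi, γ t⌋ * Real.pi, ?_⟩
    ⟨⌈y / ∫ t in (0 : ℝ)..Real.pi, γ t⌉ * Real.pi, ?_⟩
  · rw [integral_int_mul_pi hγ hper]
    exact (le_div_iff₀ hΩ).1 (Int.floor_le _)
  · rw [integral_int_mul_pi hγ hper]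
    exact (div_le_iff₀ hΩ).1 (Int.le_ceil _)

theorem integral_neg_right (heven : ∀ x, γ (-x) = γ x) (x : ℝ) :
    ∫ t in (0 : ℝ)..(-x), γ t = -∫ t in (0 : ℝ)..x, γ t := by
  have := intervalIntegral.integral_comp_neg (a := 0) (b := x) γ
  simp only [heven, neg_zero] at this
  rw [this, intervalIntegral.integral_symm]

theorem integral_pi_div_two (hγ : Continuous γ) (hper : Function.Periodic γ Real.pi)
    (heven : ∀ x, γ (-x) = γ x) :
    ∫ t in (0 : ℝ)..(Real.pi / 2), γ t = (∫ t in (0 : ℝ)..Real.pi, γ t) / 2 := by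
  have := integral_add_pi hγ hper (-(Real.pi / 2))
  rw [show -(Real.pi / 2) + Real.pi = Real.pi / 2 by ring, integral_neg_right heven] at this
  linarith

end PeriodicPrimitive

/-- If a meromorphic `d` takes the values of a `π`-periodic function `h` along a line through `0`
parametrized by a primitive of a positive `π`-periodic function, then `d` is periodic. -/
theorem MeromorphicNFOn.periodic_of_eq_on_line {d : ℂ → ℂ} (hd : MeromorphicNFOn d Set.univ)
    {c : ℂ} (hc : c ≠ 0) {γ : ℝ → ℝ} {h : ℝ → ℂ} (hγ : Continuous γ)
    (hper : Function.Periodic γ Real.pi) (hpos : ∀ x, 0 < γ x) (hh : Function.Periodic h Real.pi)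
    (hline : ∀ x : ℝ, d (c * ((∫ t in (0 : ℝ)..x, γ t : ℝ) : ℂ)) = h x) :
    Function.Periodic d (c * ((∫ t in (0 : ℝ)..Real.pi, γ t : ℝ) : ℂ)) := by
  refine hd.periodic_of_line hc fun y => ?_
  obtain ⟨x, rfl⟩ := exists_integral_eq hγ hper hpos y
  rw [hline, ← mul_add, ← Complex.ofReal_add, ← integral_add_pi hγ hper, hline, hh x]

/-! ### Local inverses and the germ of `dn₂` -/

theorem AnalyticAt.exists_local_inverse {f : ℂ → ℂ} (hf : AnalyticAt ℂ f 0) (h0 : f 0 = 0)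
    (h1 : deriv f 0 ≠ 0) : ∃ φ : ℂ → ℂ, AnalyticAt ℂ φ 0 ∧ φ 0 = 0 ∧
      (∀ᶠ z in 𝓝 0, f (φ z) = z) ∧ ∀ᶠ z in 𝓝 0, φ (f z) = z := by
  have a := hf.analyticAt_localInverse h1
  have b := HasStrictDerivAt.eventually_right_inverse hf.hasStrictDerivAt h1
  have c := HasStrictDerivAt.eventually_left_inverse hf.hasStrictDerivAt h1
  rw [h0] at a b
  refine ⟨_, a, ?_, b, c⟩
  simpa [h0] using c.self_of_nhds

/-- A right inverse germ of an analytic function with nonzero derivative is a left inverse. -/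
theorem AnalyticAt.eventually_left_inverse_of_right_inverse {f φ : ℂ → ℂ} (hf : AnalyticAt ℂ f 0)
    (h0 : f 0 = 0) (h1 : deriv f 0 ≠ 0) (hφ : AnalyticAt ℂ φ 0) (hφ0 : φ 0 = 0)
    (h : ∀ᶠ z in 𝓝 0, f (φ z) = z) : ∀ᶠ z in 𝓝 0, φ (f z) = z := by
  obtain ⟨χ, -, -, -, hχ⟩ := hf.exists_local_inverse h0 h1
  have tφ : Tendsto φ (𝓝 0) (𝓝 0) := by simpa [hφ0] using hφ.continuousAt.tendsto
  have tf : Tendsto f (𝓝 0) (𝓝 0) := by simpa [h0] using hf.continuousAt.tendsto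
  filter_upwards [hχ, tf.eventually h, tf.eventually (tφ.eventually hχ)] with z a b c
  rw [← c, b, a]

/-- The integrand `F(1/4, 3/4; 1/2; κ² sin² t)`. -/
noncomputable def dn2Integrand (κ : ℝ) (t : ℂ) : ℂ :=
  ₂F₁ (1 / 4 : ℂ) (3 / 4 : ℂ) (1 / 2 : ℂ) ((κ : ℂ) ^ 2 * Complex.sin t ^ 2)

theorem dn2Integral_eq_segmentIntegral (κ : ℝ) :
    dn2Integral κ = segmentIntegral (dn2Integrand κ) := rfl

theorem exists_differentiableOn_dn2Integrand {κ : ℝ} (hκ₀ : 0 ≤ κ) (hκ₁ : κ < 1) :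
    ∃ δ > 0, DifferentiableOn ℂ (dn2Integrand κ) (realStrip δ) := by
  obtain ⟨δ, hδ, h⟩ := exists_realStrip_mul_cosh_pow_lt_one
    (pow_lt_one₀ hκ₀ hκ₁ two_ne_zero) 2
  refine ⟨δ, hδ, fun z hz => DifferentiableAt.differentiableWithinAt ?_⟩
  have hz1 : ‖(κ : ℂ) ^ 2 * Complex.sin z ^ 2‖ < 1 := by
    rw [norm_mul, norm_pow, norm_pow, Complex.norm_real, Real.norm_of_nonneg hκ₀]
    refine lt_of_le_of_lt ?_ (h z hz)
    gcongr
    exact norm_sin_le_cosh_im z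
  exact DifferentiableAt.comp z
    (analyticAt_ordinaryHypergeometric natCast_ne_neg_params hz1).differentiableAt (by fun_prop)

section Germ

variable {κ : ℝ}

theorem eventually_hasDerivAt_dn2Integral (hκ₀ : 0 ≤ κ) (hκ₁ : κ < 1) :
    ∀ᶠ T in 𝓝 0, HasDerivAt (dn2Integral κ) (dn2Integrand κ T) T := by
  obtain ⟨δ, hδ, hg⟩ := exists_differentiableOn_dn2Integrand hκ₀ hκ₁
  have h0 : (0 : ℂ) ∈ realStrip δ := by simpa using ofReal_mem_realStrip hδ 0
  filter_upwards [(isOpen_realStrip δ).mem_nhds h0] with T hT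
  exact hasDerivAt_segmentIntegral (convex_realStrip δ) (isOpen_realStrip δ) h0 hg hT

theorem analyticAt_dn2Integral (hκ₀ : 0 ≤ κ) (hκ₁ : κ < 1) : AnalyticAt ℂ (dn2Integral κ) 0 := by
  rw [Complex.analyticAt_iff_eventually_differentiableAt]
  filter_upwards [eventually_hasDerivAt_dn2Integral hκ₀ hκ₁] with T hT using hT.differentiableAt

theorem dn2Integral_zero : dn2Integral κ 0 = 0 := by simp [dn2Integral]

theorem deriv_dn2Integral_zero (hκ₀ : 0 ≤ κ) (hκ₁ : κ < 1) : deriv (dn2Integral κ) 0 = 1 := by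
  rw [(eventually_hasDerivAt_dn2Integral hκ₀ hκ₁).self_of_nhds.deriv]
  simp [dn2Integrand]

theorem isCubicGerm_one_sub_cos {φ ψ : ℂ → ℂ} (hκ₀ : 0 < κ) (hκ₁ : κ < 1)
    (hφ : AnalyticAt ℂ φ 0) (hφ0 : φ 0 = 0) (hf : ∀ᶠ z in 𝓝 0, dn2Integral κ (φ z) = z)
    (hψ : AnalyticAt ℂ ψ 0) (hψ0 : ψ 0 = 0)
    (hs : ∀ᶠ z in 𝓝 0, Complex.sin (ψ z) = κ * Complex.sin (φ z)) :
    IsCubicGerm ((κ : ℂ) ^ 2) fun z => 1 - Complex.cos (ψ z) := by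
  have tφ : Tendsto φ (𝓝 0) (𝓝 0) := by simpa [hφ0] using hφ.continuousAt.tendsto
  have tψ : Tendsto ψ (𝓝 0) (𝓝 0) := by simpa [hψ0] using hψ.continuousAt.tendsto
  have hφ' : ∀ᶠ z in 𝓝 0, dn2Integrand κ (φ z) * deriv φ z = 1 := by
    filter_upwards [hf.eventually_nhds, hφ.eventually_analyticAt,
      tφ.eventually (eventually_hasDerivAt_dn2Integral hκ₀.le hκ₁)] with z h1 h2 h3
    exact (h3.comp z h2.differentiableAt.hasDerivAt).unique
      ((hasDerivAt_id z).congr_of_eventuallyEq h1)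
  have hψ' : ∀ᶠ z in 𝓝 0,
      Complex.cos (ψ z) * deriv ψ z = κ * (Complex.cos (φ z) * deriv φ z) := by
    filter_upwards [hs.eventually_nhds, hφ.eventually_analyticAt, hψ.eventually_analyticAt]
      with z h1 h2 h3
    exact h3.differentiableAt.hasDerivAt.csin.unique
      ((h2.differentiableAt.hasDerivAt.csin.const_mul (κ : ℂ)).congr_of_eventuallyEq h1)
  refine ⟨by fun_prop, by simp [hψ0], ?_, ?_⟩
  · filter_upwards [hφ', hψ', hs, hψ.eventually_analyticAt,
      tψ.eventually ordinaryHypergeometric_sin_sq] with z h1 h2 h3 h4 h5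
    have hd : deriv (fun z => 1 - Complex.cos (ψ z)) z = Complex.sin (ψ z) * deriv ψ z := by
      rw [(h4.differentiableAt.hasDerivAt.ccos.const_sub 1).deriv]; ring
    rw [hd]
    have hF : dn2Integrand κ (φ z) * Complex.cos (ψ z) = Complex.cos (ψ z / 2) := by
      rw [← h5, h3, mul_pow, dn2Integrand]
    have hC : Complex.cos (ψ z) = 2 * Complex.cos (ψ z / 2) ^ 2 - 1 := by
      rw [← Complex.cos_two_mul]; congr 1; ring
    -- Eliminating `φ'` makes the hypergeometric factor disappear; squaring then removes `φ`.
    have hH : Complex.cos (ψ z / 2) * deriv ψ z = κ * Complex.cos (φ z) := by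
      rw [← hF]
      linear_combination dn2Integrand κ (φ z) * h2 + κ * Complex.cos (φ z) * h1
    have p1 := Complex.sin_sq_add_cos_sq (ψ z)
    have p2 := Complex.sin_sq_add_cos_sq (φ z)
    have e1 : Complex.sin (ψ z) ^ 2 =
        2 * (1 - Complex.cos (ψ z)) * Complex.cos (ψ z / 2) ^ 2 := by
      linear_combination p1 + (1 - Complex.cos (ψ z)) * hC
    have e2 : (κ : ℂ) ^ 2 * Complex.cos (φ z) ^ 2 = κ ^ 2 - Complex.sin (ψ z) ^ 2 := by
      rw [h3]; linear_combination (κ : ℂ) ^ 2 * p2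
    calc (Complex.sin (ψ z) * deriv ψ z) ^ 2
        = 2 * (1 - Complex.cos (ψ z)) * (Complex.cos (ψ z / 2) * deriv ψ z) ^ 2 := by
          rw [mul_pow, e1]; ring
      _ = 2 * (1 - Complex.cos (ψ z)) * (κ ^ 2 - Complex.sin (ψ z) ^ 2) := by
          rw [hH, mul_pow, e2]
      _ = _ := by linear_combination -2 * (1 - Complex.cos (ψ z)) * p1
  -- If `cos ψ` were constantly 1, then `sin φ` would vanish near 0, forcing `φ'(0) = 0` against
  -- `F(φ) φ' = 1`.
  · intro h
    have hsin : ∀ᶠ z in 𝓝 0, Complex.sin (φ z) = 0 := by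
      filter_upwards [h, hs] with z h1 h2
      have p1 := Complex.sin_sq_add_cos_sq (ψ z)
      rw [← sub_eq_zero.1 h1, h2] at p1
      simpa [hκ₀.ne'] using p1
    have h1 : deriv (fun z => Complex.sin (φ z)) 0 = 0 := by
      rw [EventuallyEq.deriv_eq (f := fun _ => 0) hsin]; simp
    rw [hφ.differentiableAt.hasDerivAt.csin.deriv, hφ0, Complex.cos_zero, one_mul] at h1
    simpa [h1] using hφ'.self_of_nhds

theorem IsDn2.eventuallyEq {d₁ d₂ : ℂ → ℂ} (hκ₀ : 0 < κ) (hκ₁ : κ < 1) (h₁ : IsDn2 κ d₁)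
    (h₂ : IsDn2 κ d₂) : ∀ᶠ z in 𝓝 0, d₁ z = d₂ z := by
  obtain ⟨φ, ψ, a1, a2, a3, a4, a5, a6, a7⟩ := h₁.germ
  obtain ⟨φ', ψ', b1, b2, b3, b4, b5, b6, b7⟩ := h₂.germ
  filter_upwards [a7, b7, (isCubicGerm_one_sub_cos hκ₀ hκ₁ a1 a2 a3 a4 a5 a6).eventuallyEq
    (isCubicGerm_one_sub_cos hκ₀ hκ₁ b1 b2 b3 b4 b5 b6)] with z h1 h2 h3
  rw [h1, h2]
  exact sub_right_injective h3

theorem IsDn2.unique {d₁ d₂ : ℂ → ℂ} (hκ₀ : 0 < κ) (hκ₁ : κ < 1) (h₁ : IsDn2 κ d₁)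
    (h₂ : IsDn2 κ d₂) : d₁ = d₂ :=
  h₁.meromorphic.eq_of_frequently_eq h₂.meromorphic
    (h₁.eventuallyEq hκ₀ hκ₁ h₂).frequently_nhdsNE

theorem IsDn2.isCubicGerm {d : ℂ → ℂ} (hκ₀ : 0 < κ) (hκ₁ : κ < 1) (hd : IsDn2 κ d) :
    ∃ u : ℂ → ℂ, IsCubicGerm ((κ : ℂ) ^ 2) u ∧ ∀ᶠ z in 𝓝 0, d z = 1 - u z := by
  obtain ⟨φ, ψ, a1, a2, a3, a4, a5, a6, a7⟩ := hd.germ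
  refine ⟨_, isCubicGerm_one_sub_cos hκ₀ hκ₁ a1 a2 a3 a4 a5 a6, ?_⟩
  filter_upwards [a7] with z h
  rw [h]; ring

theorem exists_isDn2 (hκ₀ : 0 < κ) (hκ₁ : κ < 1) : ∃ d : ℂ → ℂ, IsDn2 κ d := by
  obtain ⟨φ, hφ, hφ0, hf, -⟩ := (analyticAt_dn2Integral hκ₀.le hκ₁).exists_local_inverse
    dn2Integral_zero (by rw [deriv_dn2Integral_zero hκ₀.le hκ₁]; exact one_ne_zero)
  -- `α` is the germ of arcsine, and `ψ = α (κ sin φ)`.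
  obtain ⟨α, hα, hα0, hsin, -⟩ := AnalyticAt.exists_local_inverse (f := Complex.sin)
    (by fun_prop) Complex.sin_zero (by simp)
  have hβ : AnalyticAt ℂ (fun z => (κ : ℂ) * Complex.sin (φ z)) 0 := by fun_prop
  have hβ0 : (κ : ℂ) * Complex.sin (φ 0) = 0 := by simp [hφ0]
  have tβ : Tendsto (fun z => (κ : ℂ) * Complex.sin (φ z)) (𝓝 0) (𝓝 0) := by
    simpa [hβ0] using hβ.continuousAt.tendsto
  have hψ : AnalyticAt ℂ (fun z => α (κ * Complex.sin (φ z))) 0 :=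
    AnalyticAt.fun_comp (by rwa [hβ0]) hβ
  have hψ0 : α (κ * Complex.sin (φ 0)) = 0 := by rw [hβ0, hα0]
  have hs := tβ.eventually hsin
  have hu := isCubicGerm_one_sub_cos hκ₀ hκ₁ hφ hφ0 hf hψ hψ0 hs
  obtain ⟨g, hg, hgu⟩ := hu.exists_meromorphicNFOn (by simpa using hκ₀.ne')
  have hm : MeromorphicOn (fun z => 1 - g z) Set.univ :=
    (MeromorphicOn.const 1).sub hg.meromorphicOn
  refine ⟨toMeromorphicNFOn (fun z => 1 - g z) Set.univ,
    meromorphicNFOn_toMeromorphicNFOn _ _, φ, _, hφ, hφ0, hf, hψ, hψ0, hs, ?_⟩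
  have hcos : AnalyticAt ℂ (fun z => Complex.cos (α (κ * Complex.sin (φ z)))) 0 :=
    Complex.analyticAt_cos.fun_comp hψ
  refine ((meromorphicNFOn_toMeromorphicNFOn _ _ (Set.mem_univ _)
    ).eventuallyEq_nhdsNE_iff_eventuallyEq_nhds hcos.meromorphicNFAt).1 ?_
  filter_upwards [hm.toMeromorphicNFOn_eq_self_on_nhdsNE (Set.mem_univ 0),
    hgu.filter_mono nhdsWithin_le_nhds] with z h1 h2
  rw [h1, h2]; ring

end Germ

/-! ### `dn₂` on the real axis -/

section Axes

variable {κ : ℝ}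

/-- The restriction of `dn2Integrand` to the real axis. -/
noncomputable def dn2RealSpeed (κ t : ℝ) : ℝ :=
  ₂F₁ (1 / 4 : ℝ) (3 / 4 : ℝ) (1 / 2 : ℝ) (κ ^ 2 * Real.sin t ^ 2)

theorem sq_mul_sin_sq_lt_one (hκ₀ : 0 ≤ κ) (hκ₁ : κ < 1) (x : ℝ) : κ ^ 2 * Real.sin x ^ 2 < 1 :=
  (mul_le_of_le_one_right (sq_nonneg κ) (Real.sin_sq_le_one x)).trans_lt
    (pow_lt_one₀ hκ₀ hκ₁ two_ne_zero)

theorem dn2Integrand_ofReal (κ x : ℝ) : dn2Integrand κ x = dn2RealSpeed κ x := by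
  rw [dn2Integrand, dn2RealSpeed, ofReal_ordinaryHypergeometric]
  push_cast
  rfl

theorem dn2RealSpeed_pos (hκ₀ : 0 ≤ κ) (hκ₁ : κ < 1) (x : ℝ) : 0 < dn2RealSpeed κ x :=
  ordinaryHypergeometric_pos (by norm_num) (by norm_num) (by norm_num) (by positivity)
    (sq_mul_sin_sq_lt_one hκ₀ hκ₁ x)

theorem continuous_dn2RealSpeed (hκ₀ : 0 ≤ κ) (hκ₁ : κ < 1) : Continuous (dn2RealSpeed κ) := by
  refine continuous_iff_continuousAt.2 fun x => ?_
  refine ContinuousAt.comp (f := fun t => κ ^ 2 * Real.sin t ^ 2)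
    (AnalyticAt.continuousAt (𝕜 := ℝ) (analyticAt_ordinaryHypergeometric (fun k =>
      ⟨natCast_ne_neg_of_pos (by norm_num) k, natCast_ne_neg_of_pos (by norm_num) k,
        natCast_ne_neg_of_pos (by norm_num) k⟩) ?_)) (by fun_prop)
  rw [Real.norm_of_nonneg (by positivity)]
  exact sq_mul_sin_sq_lt_one hκ₀ hκ₁ x

theorem dn2RealSpeed_periodic (κ : ℝ) : Function.Periodic (dn2RealSpeed κ) Real.pi := fun x => by
  simp [dn2RealSpeed, Real.sin_add_pi]

theorem dn2RealSpeed_neg (κ x : ℝ) : dn2RealSpeed κ (-x) = dn2RealSpeed κ x := by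
  simp [dn2RealSpeed]

/-- `cos² ψ = 1 - κ² sin² φ`, and `cos ψ` is the principal root because its real part is positive
near 0. -/
theorem IsDn2.apply_dn2Integral {d : ℂ → ℂ} (hκ₀ : 0 < κ) (hκ₁ : κ < 1) (hd : IsDn2 κ d) :
    ∀ᶠ θ in 𝓝 0, d (dn2Integral κ θ) =
      (1 - (κ : ℂ) ^ 2 * Complex.sin θ ^ 2) ^ (2⁻¹ : ℂ) := by
  obtain ⟨φ, ψ, hφ, hφ0, hf, hψ, hψ0, hs, hdψ⟩ := hd.germ
  have hfa := analyticAt_dn2Integral hκ₀.le hκ₁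
  have hinv := hfa.eventually_left_inverse_of_right_inverse dn2Integral_zero
    (by rw [deriv_dn2Integral_zero hκ₀.le hκ₁]; exact one_ne_zero) hφ hφ0 hf
  have tf : Tendsto (dn2Integral κ) (𝓝 0) (𝓝 0) := by
    simpa [dn2Integral_zero] using hfa.continuousAt.tendsto
  have hre : ∀ᶠ z in 𝓝 0, 0 < (Complex.cos (ψ z)).re := by
    have : ContinuousAt (fun z => (Complex.cos (ψ z)).re) 0 := by
      have := hψ.continuousAt
      fun_prop
    exact this.eventually_const_lt (by simp [hψ0])
  filter_upwards [hinv, tf.eventually hs, tf.eventually hdψ, tf.eventually hre] with θ h1 h2 h3 h4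
  have p := Complex.sin_sq_add_cos_sq (ψ (dn2Integral κ θ))
  rw [h2, h1] at p
  rw [h3, ← Complex.sq_cpow_two_inv h4]
  congr 1
  linear_combination p

theorem IsDn2.apply_real {d : ℂ → ℂ} (hκ₀ : 0 < κ) (hκ₁ : κ < 1) (hd : IsDn2 κ d) (x : ℝ) :
    d ((∫ t in (0 : ℝ)..x, dn2RealSpeed κ t : ℝ) : ℂ) =
      (√(1 - κ ^ 2 * Real.sin x ^ 2) : ℝ) := by
  obtain ⟨δ, hδ, hg⟩ := exists_differentiableOn_dn2Integrand hκ₀.le hκ₁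
  have hpos : ∀ y : ℝ, 0 < 1 - κ ^ 2 * Real.sin y ^ 2 := fun y =>
    sub_pos.2 (sq_mul_sin_sq_lt_one hκ₀.le hκ₁ y)
  have hcast : ∀ y : ℝ, 1 - (κ : ℂ) ^ 2 * Complex.sin y ^ 2 =
      ((1 - κ ^ 2 * Real.sin y ^ 2 : ℝ) : ℂ) := fun y => by push_cast; rfl
  have := hd.meromorphic.eq_on_line (c := 1) hδ hg (dn2Integrand_ofReal κ)
    (h := fun θ => (1 - (κ : ℂ) ^ 2 * Complex.sin θ ^ 2) ^ (2⁻¹ : ℂ))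
    (fun y => AnalyticAt.meromorphicNFAt ?_) ?_ x
  · rw [one_mul] at this
    rw [this, hcast, Real.sqrt_eq_rpow, Complex.ofReal_cpow (hpos x).le]
    norm_num
  · refine AnalyticAt.cpow (by fun_prop) analyticAt_const ?_
    rw [hcast]
    exact Complex.ofReal_mem_slitPlane.2 (hpos y)
  · simpa only [one_mul, ← dn2Integral_eq_segmentIntegral] using hd.apply_dn2Integral hκ₀ hκ₁

/-! ### `dn₂` on the imaginary axis -/

/-- The function `√2 / √(1 - (1 - κ²) cos⁴ θ)`, whose primitive parametrizes the imaginary axis. -/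
noncomputable def dn2ImagSpeed (κ t : ℝ) : ℝ := √2 / √(1 - (1 - κ ^ 2) * Real.cos t ^ 4)

/-- The complex extension of `dn2ImagSpeed`. -/
noncomputable def dn2ImagIntegrand (κ : ℝ) (t : ℂ) : ℂ :=
  (√2 : ℝ) / (1 - (1 - (κ : ℂ) ^ 2) * Complex.cos t ^ 4) ^ (2⁻¹ : ℂ)

theorem one_sub_mul_cos_pow_pos (hκ₀ : 0 < κ) (hκ₁ : κ < 1) (x : ℝ) :
    0 < 1 - (1 - κ ^ 2) * Real.cos x ^ 4 := by
  have h1 : κ ^ 2 < 1 := pow_lt_one₀ hκ₀.le hκ₁ two_ne_zero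
  have h2 : Real.cos x ^ 4 ≤ 1 := by
    have := pow_le_one₀ (n := 2) (sq_nonneg _) (Real.cos_sq_le_one x)
    rwa [← pow_mul] at this
  have h3 : (1 - κ ^ 2) * Real.cos x ^ 4 ≤ 1 - κ ^ 2 := mul_le_of_le_one_right (by linarith) h2
  have : 0 < κ ^ 2 := by positivity
  linarith

theorem dn2ImagIntegrand_ofReal (hκ₀ : 0 < κ) (hκ₁ : κ < 1) (x : ℝ) :
    dn2ImagIntegrand κ x = dn2ImagSpeed κ x := by
  rw [dn2ImagIntegrand, dn2ImagSpeed, Complex.ofReal_div,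
    Real.sqrt_eq_rpow (1 - _), Complex.ofReal_cpow (one_sub_mul_cos_pow_pos hκ₀ hκ₁ x).le]
  norm_num

theorem dn2ImagSpeed_pos (hκ₀ : 0 < κ) (hκ₁ : κ < 1) (x : ℝ) : 0 < dn2ImagSpeed κ x :=
  div_pos (by positivity) (Real.sqrt_pos.2 (one_sub_mul_cos_pow_pos hκ₀ hκ₁ x))

theorem continuous_dn2ImagSpeed (hκ₀ : 0 < κ) (hκ₁ : κ < 1) : Continuous (dn2ImagSpeed κ) :=
  Continuous.div (by fun_prop) (by fun_prop) fun x =>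
    (Real.sqrt_pos.2 (one_sub_mul_cos_pow_pos hκ₀ hκ₁ x)).ne'

theorem dn2ImagSpeed_periodic (κ : ℝ) : Function.Periodic (dn2ImagSpeed κ) Real.pi := fun x => by
  simp [dn2ImagSpeed, Real.cos_add_pi, Even.neg_pow (show Even 4 by decide)]

theorem dn2ImagSpeed_neg (κ x : ℝ) : dn2ImagSpeed κ (-x) = dn2ImagSpeed κ x := by
  simp [dn2ImagSpeed]

theorem exists_realStrip_dn2ImagIntegrand (hκ₀ : 0 < κ) (hκ₁ : κ < 1) :
    ∃ δ > 0, (∀ z ∈ realStrip δ, 1 - (1 - (κ : ℂ) ^ 2) * Complex.cos z ^ 4 ≠ 0) ∧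
      DifferentiableOn ℂ (dn2ImagIntegrand κ) (realStrip δ) := by
  have h1 : κ ^ 2 < 1 := pow_lt_one₀ hκ₀.le hκ₁ two_ne_zero
  obtain ⟨δ, hδ, h⟩ := exists_realStrip_mul_cosh_pow_lt_one (r := 1 - κ ^ 2)
    (by have : 0 < κ ^ 2 := by positivity
        linarith) 4
  have hslit : ∀ z ∈ realStrip δ,
      1 - (1 - (κ : ℂ) ^ 2) * Complex.cos z ^ 4 ∈ Complex.slitPlane := fun z hz => by
    have hn : ‖(1 - (κ : ℂ) ^ 2) * Complex.cos z ^ 4‖ < 1 := by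
      rw [norm_mul, norm_pow, show (1 - (κ : ℂ) ^ 2) = ((1 - κ ^ 2 : ℝ) : ℂ) by push_cast; rfl,
        Complex.norm_real, Real.norm_of_nonneg (by linarith)]
      refine lt_of_le_of_lt ?_ (h z hz)
      have : 0 ≤ 1 - κ ^ 2 := by linarith
      gcongr
      exact norm_cos_le_cosh_im z
    refine Complex.mem_slitPlane_iff.2 (.inl ?_)
    rw [Complex.sub_re, Complex.one_re]
    linarith [Complex.re_le_norm ((1 - (κ : ℂ) ^ 2) * Complex.cos z ^ 4)]
  refine ⟨δ, hδ, fun z hz => Complex.slitPlane_ne_zero (hslit z hz), fun z hz =>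
    DifferentiableAt.differentiableWithinAt ?_⟩
  refine DifferentiableAt.div (differentiableAt_const _)
    (DifferentiableAt.cpow (by fun_prop) (by fun_prop) (hslit z hz)) ?_
  simp [Complex.cpow_eq_zero_iff, Complex.slitPlane_ne_zero (hslit z hz)]

theorem dn2ImagIntegrand_sq_mul {z : ℂ} (hz : 1 - (1 - (κ : ℂ) ^ 2) * Complex.cos z ^ 4 ≠ 0) :
    dn2ImagIntegrand κ z ^ 2 * (1 - (1 - (κ : ℂ) ^ 2) * Complex.cos z ^ 4) = 2 := by
  have h2 : (((√2 : ℝ) : ℂ)) ^ 2 = 2 := by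
    rw [← Complex.ofReal_pow, Real.sq_sqrt zero_le_two]; norm_num
  have h3 := Complex.cpow_nat_inv_pow (1 - (1 - (κ : ℂ) ^ 2) * Complex.cos z ^ 4) two_ne_zero
  rw [Nat.cast_ofNat] at h3
  rw [dn2ImagIntegrand, div_pow, h2, h3]
  field_simp

theorem IsDn2.apply_imag_germ {d : ℂ → ℂ} (hκ₀ : 0 < κ) (hκ₁ : κ < 1) (hd : IsDn2 κ d) :
    ∀ᶠ θ in 𝓝 0, d (Complex.I * segmentIntegral (dn2ImagIntegrand κ) θ) =
      (Complex.cos θ ^ 2)⁻¹ := by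
  obtain ⟨δ, hδ, hne, hg⟩ := exists_realStrip_dn2ImagIntegrand hκ₀ hκ₁
  set g := dn2ImagIntegrand κ
  set τ := segmentIntegral g
  have h0 : (0 : ℂ) ∈ realStrip δ := by simpa using ofReal_mem_realStrip hδ 0
  have hmem := (isOpen_realStrip δ).mem_nhds h0
  have hτ' : ∀ z ∈ realStrip δ, HasDerivAt τ (g z) z := fun z hz =>
    hasDerivAt_segmentIntegral (convex_realStrip δ) (isOpen_realStrip δ) h0 hg hz
  have hτa : AnalyticAt ℂ τ 0 :=
    DifferentiableOn.analyticAt (s := realStrip δ)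
      (fun z hz => (hτ' z hz).differentiableAt.differentiableWithinAt) hmem
  have hτ0 : τ 0 = 0 := by simp [τ, segmentIntegral]
  have hgsq : ∀ z ∈ realStrip δ,
      g z ^ 2 * (1 - (1 - (κ : ℂ) ^ 2) * Complex.cos z ^ 4) = 2 := fun z hz =>
    dn2ImagIntegrand_sq_mul (hne z hz)
  obtain ⟨χ, hχ, hχ0, hr, hl⟩ := hτa.exists_local_inverse hτ0 (by
    rw [(hτ' 0 h0).deriv]
    intro h
    simpa [h] using hgsq 0 h0)
  have tχ : Tendsto χ (𝓝 0) (𝓝 0) := by simpa [hχ0] using hχ.continuousAt.tendsto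
  have tτ : Tendsto τ (𝓝 0) (𝓝 0) := by simpa [hτ0] using hτa.continuousAt.tendsto
  have tI : ∀ c : ℂ, Tendsto (fun z : ℂ => c * z) (𝓝 0) (𝓝 0) := fun c => by
    simpa using (continuous_id.const_mul c).tendsto (0 : ℂ)
  have hχ' : ∀ᶠ s in 𝓝 0, g (χ s) * deriv χ s = 1 := by
    filter_upwards [hr.eventually_nhds, hχ.eventually_analyticAt, tχ.eventually hmem]
      with s h1 h2 h3
    exact ((hτ' _ h3).comp s h2.differentiableAt.hasDerivAt).unique
      ((hasDerivAt_id s).congr_of_eventuallyEq h1)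
  have hcos : ∀ᶠ s in 𝓝 0, Complex.cos (χ s) ≠ 0 := by
    have : ContinuousAt (fun s => Complex.cos (χ s)) 0 := by
      have := hχ.continuousAt
      fun_prop
    exact this.eventually_ne (by simp [hχ0])
  have hχI : AnalyticAt ℂ (fun z => χ (-Complex.I * z)) 0 :=
    AnalyticAt.fun_comp (by simpa using hχ) (by fun_prop)
  -- Here `χ` inverts `τ`, so `z = iτ(θ)` corresponds to `θ = χ(-iz)`. The speed `g` is exactly the
  -- one for which `1 - 1/cos² θ` solves the cubic equation in `z`.
  have hW : IsCubicGerm ((κ : ℂ) ^ 2) fun z => 1 - (Complex.cos (χ (-Complex.I * z)) ^ 2)⁻¹ := by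
    refine ⟨?_, by simp [hχ0], ?_, ?_⟩
    · refine analyticAt_const.sub (AnalyticAt.inv ?_ (by simp [hχ0]))
      exact (Complex.analyticAt_cos.fun_comp hχI).pow 2
    · filter_upwards [(tI (-Complex.I)).eventually hχ', (tI (-Complex.I)).eventually hcos,
        (tI (-Complex.I)).eventually hχ.eventually_analyticAt,
        (tI (-Complex.I)).eventually (tχ.eventually hmem)] with z h1 h2 h3 h4
      have d0 : HasDerivAt (fun z => χ (-Complex.I * z))
          (deriv χ (-Complex.I * z) * (-Complex.I)) z :=
        HasDerivAt.comp z h3.differentiableAt.hasDerivAt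
          (hasDerivAt_const_mul (-Complex.I))
      have d1 := ((d0.ccos.pow 2).inv (pow_ne_zero 2 h2)).const_sub 1
      have d2 : deriv (fun z => 1 - (Complex.cos (χ (-Complex.I * z)) ^ 2)⁻¹) z = _ := d1.deriv
      have d3 : deriv (fun z => 1 - (Complex.cos (χ (-Complex.I * z)) ^ 2)⁻¹) z =
          2 * Complex.sin (χ (-Complex.I * z)) * Complex.I * deriv χ (-Complex.I * z) /
            Complex.cos (χ (-Complex.I * z)) ^ 3 := by
        rw [d2]
        simp only [Pi.pow_apply]
        generalize χ (-Complex.I * z) = w at h2 ⊢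
        field_simp
        ring
      have hq := hgsq _ h4
      have p := Complex.sin_sq_add_cos_sq (χ (-Complex.I * z))
      rw [d3]
      generalize χ (-Complex.I * z) = w at *
      generalize deriv χ (-Complex.I * z) = y at *
      have hy : 2 * y ^ 2 = 1 - (1 - (κ : ℂ) ^ 2) * Complex.cos w ^ 4 := by
        linear_combination (1 - (1 - (κ : ℂ) ^ 2) * Complex.cos w ^ 4) * (g w * y + 1) * h1 -
          y ^ 2 * hq
      have hI := Complex.I_sq
      have hsq : (2 * Complex.sin w * Complex.I * y) ^ 2 = -2 * (1 - Complex.cos w ^ 2) *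
          (1 - (1 - (κ : ℂ) ^ 2) * Complex.cos w ^ 4) := by
        linear_combination 4 * Complex.sin w ^ 2 * y ^ 2 * hI - 2 * Complex.sin w ^ 2 * hy -
          2 * (1 - (1 - (κ : ℂ) ^ 2) * Complex.cos w ^ 4) * p
      rw [div_pow, hsq]
      field_simp
      ring
    · intro h
      have : ∀ᶠ θ in 𝓝 0, Complex.sin θ = 0 := by
        filter_upwards [(tI Complex.I).comp tτ |>.eventually h, hl] with θ h1 h2
        simp only [Function.comp_apply, ← mul_assoc, neg_mul, Complex.I_mul_I, neg_neg, one_mul,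
          h2] at h1
        have p := Complex.sin_sq_add_cos_sq θ
        rw [sub_eq_zero, eq_comm, inv_eq_one] at h1
        rw [h1] at p
        simpa using p
      have h1 : deriv Complex.sin 0 = 0 := by
        rw [EventuallyEq.deriv_eq (f := fun _ => 0) this]; simp
      simp at h1
  obtain ⟨u, hu, hdu⟩ := hd.isCubicGerm hκ₀ hκ₁
  filter_upwards [(tI Complex.I).comp tτ |>.eventually (hu.eventuallyEq hW),
    (tI Complex.I).comp tτ |>.eventually hdu, hl] with θ h1 h2 h3
  simp only [Function.comp_apply, ← mul_assoc, neg_mul, Complex.I_mul_I, neg_neg, one_mul,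
    h3] at h1 h2
  rw [h2, h1]; ring

theorem IsDn2.apply_imag {d : ℂ → ℂ} (hκ₀ : 0 < κ) (hκ₁ : κ < 1) (hd : IsDn2 κ d) (x : ℝ) :
    d (Complex.I * ((∫ t in (0 : ℝ)..x, dn2ImagSpeed κ t : ℝ) : ℂ)) =
      (Complex.cos x ^ 2)⁻¹ := by
  obtain ⟨δ, hδ, -, hg⟩ := exists_realStrip_dn2ImagIntegrand hκ₀ hκ₁
  refine hd.meromorphic.eq_on_line (h := fun θ => (Complex.cos θ ^ 2)⁻¹) hδ hg
    (dn2ImagIntegrand_ofReal hκ₀ hκ₁) (fun y => ?_) (hd.apply_imag_germ hκ₀ hκ₁) x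
  have : AnalyticAt ℂ (fun θ => Complex.cos θ ^ 2) (y : ℂ) := by fun_prop
  -- At odd multiples of `π/2` the inverse is 0, which is the normal-form value at a pole.
  exact this.meromorphicNFAt.inv

end Axes

/-! ### The periods of `dn₂` -/

namespace IsDn2

variable {κ : ℝ} {d : ℂ → ℂ}

theorem periodic_real (hκ₀ : 0 < κ) (hκ₁ : κ < 1) (hd : IsDn2 κ d) :
    Function.Periodic d ((∫ t in (0 : ℝ)..Real.pi, dn2RealSpeed κ t : ℝ) : ℂ) := by
  have := hd.meromorphic.periodic_of_eq_on_line one_ne_zero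
    (h := fun x => ((√(1 - κ ^ 2 * Real.sin x ^ 2) : ℝ) : ℂ))
    (continuous_dn2RealSpeed hκ₀.le hκ₁) (dn2RealSpeed_periodic κ) (dn2RealSpeed_pos hκ₀.le hκ₁)
    (fun x => by simp [Real.sin_add_pi]) (fun x => by rw [one_mul, hd.apply_real hκ₀ hκ₁])
  rwa [one_mul] at this

theorem periodic_imag (hκ₀ : 0 < κ) (hκ₁ : κ < 1) (hd : IsDn2 κ d) :
    Function.Periodic d (Complex.I * ((∫ t in (0 : ℝ)..Real.pi, dn2ImagSpeed κ t : ℝ) : ℂ)) :=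
  hd.meromorphic.periodic_of_eq_on_line Complex.I_ne_zero
    (h := fun x : ℝ => (Complex.cos x ^ 2)⁻¹)
    (continuous_dn2ImagSpeed hκ₀ hκ₁) (dn2ImagSpeed_periodic κ) (dn2ImagSpeed_pos hκ₀ hκ₁)
    (fun x => by simp [Complex.cos_add_pi]) (fun x => hd.apply_imag hκ₀ hκ₁ x)

theorem apply_zero (hκ₀ : 0 < κ) (hκ₁ : κ < 1) (hd : IsDn2 κ d) : d 0 = 1 := by
  simpa using hd.apply_real hκ₀ hκ₁ 0

theorem exists_int_of_apply_real_eq_one (hκ₀ : 0 < κ) (hκ₁ : κ < 1) (hd : IsDn2 κ d) {y : ℝ}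
    (h : d y = 1) : ∃ m : ℤ, y = m * ∫ t in (0 : ℝ)..Real.pi, dn2RealSpeed κ t := by
  obtain ⟨x, rfl⟩ := exists_integral_eq (continuous_dn2RealSpeed hκ₀.le hκ₁)
    (dn2RealSpeed_periodic κ) (dn2RealSpeed_pos hκ₀.le hκ₁) y
  rw [hd.apply_real hκ₀ hκ₁, Complex.ofReal_eq_one, Real.sqrt_eq_one, sub_eq_self] at h
  obtain ⟨m, rfl⟩ := Real.sin_eq_zero_iff.1 (by simpa [hκ₀.ne'] using h)
  exact ⟨m, integral_int_mul_pi (continuous_dn2RealSpeed hκ₀.le hκ₁) (dn2RealSpeed_periodic κ) m⟩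

theorem exists_int_of_apply_imag_eq_one (hκ₀ : 0 < κ) (hκ₁ : κ < 1) (hd : IsDn2 κ d) {y : ℝ}
    (h : d (Complex.I * y) = 1) :
    ∃ n : ℤ, y = n * ∫ t in (0 : ℝ)..Real.pi, dn2ImagSpeed κ t := by
  obtain ⟨x, rfl⟩ := exists_integral_eq (continuous_dn2ImagSpeed hκ₀ hκ₁)
    (dn2ImagSpeed_periodic κ) (dn2ImagSpeed_pos hκ₀ hκ₁) y
  rw [hd.apply_imag hκ₀ hκ₁, inv_eq_one] at h
  have hs : Real.sin x = 0 := by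
    have p := Real.sin_sq_add_cos_sq x
    rw [show Real.cos x ^ 2 = 1 by exact_mod_cast h] at p
    simpa using p
  obtain ⟨n, rfl⟩ := Real.sin_eq_zero_iff.1 hs
  exact ⟨n, integral_int_mul_pi (continuous_dn2ImagSpeed hκ₀ hκ₁) (dn2ImagSpeed_periodic κ) n⟩

/-- Schwarz reflection: `d` is real on the real axis, all of which is reached by the real
parametrization. -/
theorem apply_conj (hκ₀ : 0 < κ) (hκ₁ : κ < 1) (hd : IsDn2 κ d) (z : ℂ) :
    d (starRingEnd ℂ z) = starRingEnd ℂ (d z) := by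
  have hreal : ∀ y : ℝ, starRingEnd ℂ (d y) = d y := fun y => by
    obtain ⟨x, rfl⟩ := exists_integral_eq (continuous_dn2RealSpeed hκ₀.le hκ₁)
      (dn2RealSpeed_periodic κ) (dn2RealSpeed_pos hκ₀.le hκ₁) y
    rw [hd.apply_real hκ₀ hκ₁, Complex.conj_ofReal]
  have h1 : MeromorphicNFOn (fun z => starRingEnd ℂ (d (starRingEnd ℂ z))) Set.univ := fun z _ =>
    (hd.meromorphic (Set.mem_univ _)).conj_comp_conj
  have ht : Tendsto (fun x : ℝ => (x : ℂ)) (𝓝[≠] 0) (𝓝[≠] 0) := by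
    refine tendsto_nhdsWithin_iff.2 ⟨?_, ?_⟩
    · simpa using (Complex.continuous_ofReal.tendsto 0).mono_left nhdsWithin_le_nhds
    · filter_upwards [self_mem_nhdsWithin] with x hx
      simpa using hx
  have h2 := h1.eq_of_frequently_eq hd.meromorphic (x := 0)
    (ht.frequently (Eventually.frequently (.of_forall fun x => by
      rw [Complex.conj_ofReal, hreal])))
  have h3 := congrFun h2 (starRingEnd ℂ z)
  simpa using h3.symm

theorem periodic_conj (hκ₀ : 0 < κ) (hκ₁ : κ < 1) (hd : IsDn2 κ d) {w : ℂ}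
    (hw : Function.Periodic d w) : Function.Periodic d (starRingEnd ℂ w) := fun z => by
  have := hw (starRingEnd ℂ z)
  rw [hd.apply_conj hκ₀ hκ₁] at this
  have h := hd.apply_conj hκ₀ hκ₁ (starRingEnd ℂ z + w)
  rw [this, map_add, Complex.conj_conj, Complex.conj_conj] at h
  exact h

theorem isFundamentalHalfPeriods (hκ₀ : 0 < κ) (hκ₁ : κ < 1) (hd : IsDn2 κ d) :
    IsFundamentalHalfPeriods d ((∫ t in (0 : ℝ)..Real.pi, dn2RealSpeed κ t) / 2)
      ((∫ t in (0 : ℝ)..Real.pi, dn2ImagSpeed κ t) / 2) := by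
  have hR := integral_pi_pos (continuous_dn2RealSpeed hκ₀.le hκ₁) (dn2RealSpeed_pos hκ₀.le hκ₁)
  have hJ := integral_pi_pos (continuous_dn2ImagSpeed hκ₀ hκ₁) (dn2ImagSpeed_pos hκ₀ hκ₁)
  have pR := hd.periodic_real hκ₀ hκ₁
  have pJ := hd.periodic_imag hκ₀ hκ₁
  have rR := integral_pi_div_two (continuous_dn2RealSpeed hκ₀.le hκ₁) (dn2RealSpeed_periodic κ)
    (dn2RealSpeed_neg κ)
  have rJ := integral_pi_div_two (continuous_dn2ImagSpeed hκ₀ hκ₁) (dn2ImagSpeed_periodic κ)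
    (dn2ImagSpeed_neg κ)
  have vR := hd.apply_real hκ₀ hκ₁ (Real.pi / 2)
  have vJ := hd.apply_imag hκ₀ hκ₁ (Real.pi / 2)
  have vJ' := hd.apply_imag hκ₀ hκ₁ (-(Real.pi / 2))
  rw [integral_neg_right (dn2ImagSpeed_neg κ)] at vJ'
  have oneR := fun y => hd.exists_int_of_apply_real_eq_one hκ₀ hκ₁ (y := y)
  have oneJ := fun y => hd.exists_int_of_apply_imag_eq_one hκ₀ hκ₁ (y := y)
  rw [rR, Real.sin_pi_div_two] at vR
  rw [rJ] at vJ vJ'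
  generalize (∫ t in (0 : ℝ)..Real.pi, dn2RealSpeed κ t) = R at *
  generalize (∫ t in (0 : ℝ)..Real.pi, dn2ImagSpeed κ t) = J at *
  have hκ2 : κ ^ 2 < 1 := pow_lt_one₀ hκ₀.le hκ₁ two_ne_zero
  have v0 : d 0 = 1 := hd.apply_zero hκ₀ hκ₁
  have vR1 : d ((R / 2 : ℝ) : ℂ) ≠ 1 := by
    rw [vR, Ne, Complex.ofReal_eq_one, Real.sqrt_eq_one]
    simp [hκ₀.ne']
  have vR0 : d ((R / 2 : ℝ) : ℂ) ≠ 0 := by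
    rw [vR, Ne, Complex.ofReal_eq_zero, Real.sqrt_eq_zero (by linarith)]
    simp; linarith
  have cpi : Complex.cos ((Real.pi / 2 : ℝ) : ℂ) = 0 := by
    rw [← Complex.ofReal_cos, Real.cos_pi_div_two, Complex.ofReal_zero]
  rw [cpi] at vJ
  rw [Complex.ofReal_neg (Real.pi / 2), Complex.cos_neg, cpi] at vJ'
  simp only [ne_eq, OfNat.ofNat_ne_zero, not_false_eq_true, zero_pow, inv_zero] at vJ vJ'
  have lattice : ∀ m n : ℤ, Function.Periodic d (m * (R : ℂ) + n * (Complex.I * J)) := fun m n =>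
    (pR.int_mul m).add_period (pJ.int_mul n)
  refine ⟨half_pos hR, half_pos hJ, fun w => ⟨fun hw => ?_, ?_⟩⟩
  · have hwc := hd.periodic_conj hκ₀ hκ₁ hw
    -- Both `w + w̄ = 2 Re w` and `w - w̄ = 2i Im w` are periods, so `d` is 1 there and `w` lies in
    -- the half-lattice.
    have h1 : d ((2 * w.re : ℝ) : ℂ) = 1 := by
      rw [← v0, ← (hw.add_period hwc) 0, zero_add, Complex.add_conj]
    have h2 : d (Complex.I * ((2 * w.im : ℝ) : ℂ)) = 1 := by
      rw [← v0, ← (hw.sub_period hwc) 0, zero_add, Complex.sub_conj, mul_comm]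
    obtain ⟨m, hm⟩ := oneR _ h1
    obtain ⟨n, hn⟩ := oneJ _ h2
    have hwmn : w = m * (R : ℂ) / 2 + n * (Complex.I * J) / 2 := by
      apply Complex.ext
      · simp; linarith
      · simp; linarith
    obtain ⟨a, ha⟩ := Int.even_or_odd' m
    obtain ⟨b, hb⟩ := Int.even_or_odd' n
    have hred : Function.Periodic d (w - (a * (R : ℂ) + b * (Complex.I * J))) :=
      hw.sub_period (lattice a b)
    rcases ha with rfl | rfl <;> rcases hb with rfl | rfl
    · refine ⟨a, b, ?_⟩
      rw [hwmn]; push_cast; ring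
    -- `iJ/2` is not a period: `d` has the value 0 there (a pole), but 1 at 0.
    · exfalso
      have e : w - (a * (R : ℂ) + b * (Complex.I * J)) = Complex.I * ((J / 2 : ℝ) : ℂ) := by
        rw [hwmn]; push_cast; ring
      have := hred 0
      rw [zero_add, e, vJ, v0] at this
      exact zero_ne_one this
    -- `R/2` is not a period: `d(R/2) = √(1 - κ²) ≠ 1`.
    · exfalso
      have e : w - (a * (R : ℂ) + b * (Complex.I * J)) = ((R / 2 : ℝ) : ℂ) := by
        rw [hwmn]; push_cast; ring
      have := hred 0
      rw [zero_add, e, v0] at this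
      exact vR1 this
    -- The period `R/2 + iJ/2` would carry `-iJ/2`, where `d` is 0, to `R/2`, where `d` is `√(1 -
    -- κ²) ≠ 0`.
    · exfalso
      have e : Complex.I * ((-(J / 2) : ℝ) : ℂ) + (w - (a * (R : ℂ) + b * (Complex.I * J))) =
          ((R / 2 : ℝ) : ℂ) := by
        rw [hwmn]; push_cast; ring
      have := hred (Complex.I * ((-(J / 2) : ℝ) : ℂ))
      rw [e, vJ'] at this
      exact vR0 this
  · rintro ⟨m, n, rfl⟩
    convert! lattice m n using 1
    push_cast; ring

end IsDn2

/-! ### Uniqueness of the real half-period and the main theorem -/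

theorem IsFundamentalHalfPeriods.unique_real {d : ℂ → ℂ} {K₁ K₁' K₂ K₂' : ℝ}
    (h₁ : IsFundamentalHalfPeriods d K₁ K₁') (h₂ : IsFundamentalHalfPeriods d K₂ K₂') :
    K₁ = K₂ := by
  have key : ∀ {K L K' L' : ℝ}, IsFundamentalHalfPeriods d K K' →
      IsFundamentalHalfPeriods d L L' → L ≤ K := by
    intro K L K' L' h h'
    obtain ⟨m, n, hmn⟩ := (h'.periodic_iff (2 * (K : ℂ))).1
      ((h.periodic_iff _).2 ⟨1, 0, by simp⟩)
    have hre := congrArg Complex.re hmn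
    simp at hre
    -- Real parts give `K = m L` with `m` an integer; positivity forces `m ≥ 1`, so `L ≤ K`, and
    -- symmetry gives equality.
    have hm : (0 : ℝ) < m := by
      have : 0 < (m : ℝ) * L := by linarith [h.pos]
      exact pos_of_mul_pos_left this h'.pos.le
    have hm1 : (1 : ℝ) ≤ m := by exact_mod_cast hm
    have := mul_le_mul_of_nonneg_right hm1 h'.pos.le
    linarith
  exact le_antisymm (key h₂ h₁) (key h₁ h₂)

theorem mainTheorem2 (κ : ℝ) (hκ₀ : 0 < κ) (hκ₁ : κ < 1) :
    (∃! d : ℂ → ℂ, IsDn2 κ d) ∧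
    ∀ d : ℂ → ℂ, IsDn2 κ d →
      (∃ K K' : ℝ, IsFundamentalHalfPeriods d K K') ∧
      ∀ K K' : ℝ, IsFundamentalHalfPeriods d K K' →
        K = Real.pi / 2 * ₂F₁ (1 / 4 : ℝ) (3 / 4 : ℝ) (1 : ℝ) (κ ^ 2) := by
  obtain ⟨d₀, hd₀⟩ := exists_isDn2 hκ₀ hκ₁
  refine ⟨⟨d₀, hd₀, fun d hd => hd.unique hκ₀ hκ₁ hd₀⟩, fun d hd =>
    ⟨⟨_, _, hd.isFundamentalHalfPeriods hκ₀ hκ₁⟩, fun K K' h => ?_⟩⟩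
  rw [h.unique_real (hd.isFundamentalHalfPeriods hκ₀ hκ₁)]
  have := integral_ordinaryHypergeometric_sin_sq hκ₀.le hκ₁
  simp only [dn2RealSpeed]
  rw [this]; ring
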